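/- **Setting.** A transmitter at $\mathbf a\in\mathbb R^2$ emits $\sqrt E\,s(t)$, with $E>0$ and $s:\mathbb R\to\mathbb C$. Receiver $n$, at $\mathbf a_n\in\mathbb R^2$, has noise variance $\sigma_n^2>0$ and estimates $\hat\tau_n\in\mathbb R$, $\hat\alpha_n\in\mathbb C$. Let $c>0$ be the speed of light, $T_s>0$ the sampling period, $T_d\in\mathbb R$, $K\in\mathbb N$, $\hat{\boldsymbol\theta}\in\mathbb R^2$, and let $\Omega$ be a fixed finite set of selected receivers. Put $\mathcal K_n=\{k\in\mathbb Z:\ \hat\tau_n-T_d/2\le kT_s\le\hat\tau_n+T_d/2\}$ and $K_n=|\mathcal K_n|$. For $a\in\mathbb C^{\mathcal K_n}$ let $[a]\in\mathbb R^{2K_n}$ list the real parts and then the imaginary parts of $a$. With $$\mathrm{CRLB}_{\hat\tau_n}=\Big(\tfrac{2E}{\sigma_n^2}|\hat\alpha_n|^2\sum_{k=1}^K|s'(kT_s-\hat\tau_n)|^2\Big)^{-1},\qquad \mathrm{CRLB}_{\hat\alpha_n}=\Big(\tfrac{2E}{\sigma_n^2}\sum_{k=1}^K|s(kT_s-\hat\tau_n)|^2\Big)^{-1},$$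 $p_n=[\hat\alpha_n s'(kT_s-\hat\tau_n)]$, $q_{n1}=[s(kT_s-\hat\tau_n)]$, $q_{n2}=[\mathrm i\,s(kT_s-\hat\tau_n)]$, let $$\mathbf Q_{\mathbf r_n}=E\,\mathrm{CRLB}_{\hat\tau_n}p_np_n^T+\tfrac E2\mathrm{CRLB}_{\hat\alpha_n}(q_{n1}q_{n1}^T+q_{n2}q_{n2}^T)+\tfrac12\sigma_n^2\mathbf I=\mathbf U_n\,\mathrm{diag}(\gamma_{n1},\dots,\gamma_{n(2K_n)})\,\mathbf U_n^T$$ be an eigenvalue decomposition with $\mathbf U_n$ orthogonal. Let $\mathbf s_n(\boldsymbol\theta)=[\sqrt E\,\hat\alpha_n s(kT_s-\tau_n(\boldsymbol\theta))]$ with $\tau_n(\boldsymbol\theta)=(\|\mathbf a-\boldsymbol\theta\|+\|\mathbf a_n-\boldsymbol\theta\|)/c$, and let $\mathbf D_n=\partial\mathbf s_n/\partial\boldsymbol\theta\in\mathbb R^{2\times 2K_n}$ at $\hat{\boldsymbol\theta}$. **Relaxed problem.** The variables are $\boldsymbol x=(\{X_{nj}\}_{n\in\Omega,\,j\le 2K_n},W,\mathrm{vec}(\mathbf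 M))$, with Euclidean norm and domain $\mathcal X=\{X_{nj}\ge0,\ W>0,\ \mathbf M\in\mathbb R^{2\times2}\text{ symmetric}\}$. Let $$\mathbf J(\boldsymbol x)=\sum_{n\in\Omega}\mathbf D_n\Big(\tfrac12\sigma_n^2\mathbf I+\mathbf U_n\,\mathrm{diag}_j\big(\gamma_{nj}/2^{2X_{nj}-1}\big)\mathbf U_n^T\Big)^{-1}\mathbf D_n^T=\sum_{n\in\Omega}\mathbf D_n\mathbf U_n\,\mathrm{diag}_j\big(y_{nj}(X_{nj})\big)(\mathbf D_n\mathbf U_n)^T,$$ where $y_{nj}(X)=\dfrac{2^{2X-1}}{\gamma_{nj}+2^{2X-2}\sigma_n^2}$, let $\mathbf G(\boldsymbol x)=\begin{bmatrix}\mathbf M&\mathbf I_2\\ \mathbf I_2&\mathbf J(\boldsymbol x)\end{bmatrix}$, and for $\emptyset\ne\mathcal S\subseteq\Omega$ let $C_{\mathcal S}=\log_2\big(1+\sum_{n\in\mathcal S}P_ng_n/N_0\big)$ with $P_n,g_n,N_0>0$. For a given $\epsilon\in\mathbb R$ the relaxed bit-allocation problem is to minimise $f_0(\boldsymbol x)=W$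 over $\boldsymbol x\in\mathcal X$ subject to $f_i(\boldsymbol x)\le0$, where the $f_i$, $i=1,\dots,m$, are: $f_1=-\lambda_{\min}(\mathbf G(\boldsymbol x))$; $f_2=\mathrm{tr}(\mathbf M)-\epsilon$; and, for each non-empty $\mathcal S\subseteq\Omega$, the capacity constraint function, written either (for all $\mathcal S$) as $\sum_{n\in\mathcal S}\sum_jX_{nj}/W-C_{\mathcal S}$ or (for all $\mathcal S$) as $\sum_{n\in\mathcal S}\sum_jX_{nj}-W\,C_{\mathcal S}$. **Algorithm.** Let $\mu>0$ and let $(\beta^t)_{t\ge0}$ be decreasing with $\beta^t\to0$ and $\sum_t\beta^t=\infty$. Given $\boldsymbol x^t$, let $\bar{\mathbf G}^t(\boldsymbol x)$ be $\mathbf G(\boldsymbol x)$ with each $y_{nj}(X_{nj})$ replaced by its tangent $y_{nj}(X^t_{nj})+y_{nj}'(X^t_{nj})(X_{nj}-X^t_{nj})$, and put $\bar f_1^t(\boldsymbol x)=-\lambda_{\min}(\bar{\mathbf G}^t(\boldsymbol x))+\mu\|\boldsymbol x-\boldsymbol x^t\|^2$ and $\bar f_i^t(\boldsymbol x)=f_i(\boldsymbol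 x)+\mu\|\boldsymbol x-\boldsymbol x^t\|^2$ for $i\ne1$. Let $\boldsymbol x^0$ be feasible for the relaxed problem, and for every $t\ge 0$ let $\boldsymbol x^{t+1}$ be a minimiser of $\bar f_0^t$ over $\{\boldsymbol x\in\mathcal X:\ \bar f_i^t(\boldsymbol x)\le0\ (1\le i\le m),\ \|\boldsymbol x-\boldsymbol x^t\|^2\le(\beta^t)^2\}$. **Theorem 1.** Let $\boldsymbol x^*\in\mathcal X$ be the limit of a subsequence $(\boldsymbol x^{t_k})_k$ of the iterates, and suppose that Slater's condition holds for it: the limits $\hat f_i(\boldsymbol x)=\lim_k\bar f_i^{t_k}(\boldsymbol x)$ ($\boldsymbol x\in\mathcal X$, $1\le i\le m$) exist and there is $\boldsymbol x\in\mathrm{relint}\,\mathcal X$ with $\hat f_i(\boldsymbol x)<0$ for all $i=1,\dots,m$. Then $\boldsymbol x^*$ is a KKT (stationary) point of the relaxed problem: it is feasible, and there are multipliers $\lambda_1,\dots,\lambda_m\ge0$ with $\lambda_if_i(\boldsymbol x^*)=0$ for all $i$ and $$0\in\partial f_0(\boldsymbol x^*)+\sum_{i=1}^m\lambda_i\,\partial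 f_i(\boldsymbol x^*)+N_{\mathcal X}(\boldsymbol x^*).$$ Here $N_{\mathcal X}$ is the normal cone of the convex set $\mathcal X$, and $\partial$ is the Fréchet subdifferential, so that $\partial f_i(\boldsymbol x^*)=\{\nabla f_i(\boldsymbol x^*)\}$ wherever $f_i$ is differentiable (only $f_1$ may fail to be); for the purpose of $\partial f_1$, $\lambda_{\min}$ is extended to non-symmetric matrices as the minimum of the Rayleigh quotient. -/

import Mathlib

open Filter Topology
open scoped Matrix InnerProductSpace

noncomputable section

namespace MCSCA

/-! ### Constrained minimisation: solutions, Fréchet subgradients, KKT points -/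

section Optimization

variable {E I : Type*} [NormedAddCommGroup E] [InnerProductSpace ℝ E]

/-- `x` is feasible for `min f₀` over `𝒳` subject to `f i ≤ 0` for all `i`. -/
def IsFeasible (𝒳 : Set E) (f : I → E → ℝ) (x : E) : Prop :=
  x ∈ 𝒳 ∧ ∀ i, f i x ≤ 0

/-- `x` is a (global) solution of `min f₀` over `𝒳` subject to `f i ≤ 0` for all `i`. -/
def IsSolution (𝒳 : Set E) (f₀ : E → ℝ) (f : I → E → ℝ) (x : E) : Prop :=
  IsFeasible 𝒳 f x ∧ ∀ z, IsFeasible 𝒳 f z → f₀ x ≤ f₀ z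

/-- The Fréchet subdifferential of `f` at `x`: all `ξ` with
`f z ≥ f x + ⟪ξ, z - x⟫ - o(‖z - x‖)` as `z → x`.
It is `{∇ f x}` when `f` is differentiable at `x`, and the usual subdifferential when `f` is
convex. -/
def subdiff (f : E → ℝ) (x : E) : Set E :=
  {ξ | ∀ ε > 0, ∀ᶠ z in 𝓝 x, f x + ⟪ξ, z - x⟫_ℝ - ε * ‖z - x‖ ≤ f z}

/-- The normal cone to the convex set `𝒳` at `x`. -/
def normalCone (𝒳 : Set E) (x : E) : Set E :=
  {ζ | ∀ z ∈ 𝒳, ⟪ζ, z - x⟫_ℝ ≤ 0}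

/-- `x` is a KKT (stationary) point of `min f₀` over `𝒳` subject to `f i ≤ 0` for all `i`. -/
def IsKKT [Fintype I] (𝒳 : Set E) (f₀ : E → ℝ) (f : I → E → ℝ) (x : E) : Prop :=
  IsFeasible 𝒳 f x ∧
  ∃ (lam : I → ℝ) (ξ₀ : E) (ξ : I → E) (ζ : E),
    (∀ i, 0 ≤ lam i) ∧ (∀ i, lam i * f i x = 0) ∧
    ξ₀ ∈ subdiff f₀ x ∧ (∀ i, ξ i ∈ subdiff (f i) x) ∧ ζ ∈ normalCone 𝒳 x ∧
    ξ₀ + ∑ i, lam i • ξ i + ζ = 0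

end Optimization

/-! ### Smallest eigenvalue -/

/-- The smallest eigenvalue of a symmetric matrix, as the minimum of its Rayleigh quotient;
see `isLeast_minEig`. -/
def minEig {n : Type*} [Fintype n] (A : Matrix n n ℝ) : ℝ :=
  ⨅ v : {v : n → ℝ // v ≠ 0}, (v.1 ⬝ᵥ (A *ᵥ v.1)) / (v.1 ⬝ᵥ v.1)

/-- For a symmetric matrix, `minEig` is the smallest eigenvalue. -/
theorem isLeast_minEig {n : Type*} [Fintype n] [DecidableEq n] [Nonempty n] (A : Matrix n n ℝ)
    (hA : A.IsSymm) :
    IsLeast {a : ℝ | Module.End.HasEigenvalue (Matrix.toLin' A) a} (minEig A) := by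
  have hT : (Matrix.toEuclideanLin A).IsSymmetric :=
    Matrix.isSymmetric_toEuclideanLin_iff.mpr (by simpa [Matrix.IsHermitian, Matrix.IsSymm] using hA)
  have hq : ∀ v : n → ℝ, inner ℝ (Matrix.toEuclideanLin A (WithLp.toLp 2 v)) (WithLp.toLp 2 v)
      / ‖(WithLp.toLp 2 v : EuclideanSpace ℝ n)‖ ^ 2 = (v ⬝ᵥ (A *ᵥ v)) / (v ⬝ᵥ v) := by
    intro v
    rw [← real_inner_self_eq_norm_sq, EuclideanSpace.inner_eq_star_dotProduct,
      EuclideanSpace.inner_eq_star_dotProduct]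
    simp
  have hmin : minEig A = ⨅ x : {x : EuclideanSpace ℝ n // x ≠ 0},
      RCLike.re (inner ℝ (Matrix.toEuclideanLin A x.1) x.1) / ‖x.1‖ ^ 2 := by
    unfold minEig
    refine Equiv.iInf_congr ((WithLp.linearEquiv 2 ℝ (n → ℝ)).symm.toEquiv.subtypeEquiv ?_) ?_
    · intro a; simp
    · rintro ⟨v, hv⟩
      exact hq v
  have key : ∀ a : ℝ, Module.End.HasEigenvalue (Matrix.toLin' A) a ↔
      Module.End.HasEigenvalue (Matrix.toEuclideanLin A) a := by
    intro a
    rw [Module.End.hasEigenvalue_iff_mem_spectrum, Module.End.hasEigenvalue_iff_mem_spectrum,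
      Matrix.spectrum_toLin', Matrix.spectrum_toLpLin]
  constructor
  · show Module.End.HasEigenvalue _ _
    rw [key, hmin]
    exact hT.hasEigenvalue_iInf_of_finiteDimensional
  · intro a ha
    obtain ⟨v, hv⟩ := Module.End.HasEigenvalue.exists_hasEigenvector ha
    have hv0 : v ≠ 0 := hv.2
    have hAv : A *ᵥ v = a • v := by simpa using hv.apply_eq_smul
    have hvv : v ⬝ᵥ v ≠ 0 := by simpa using hv0
    have hbdd : BddBelow (Set.range fun v : {v : n → ℝ // v ≠ 0} =>
        (v.1 ⬝ᵥ (A *ᵥ v.1)) / (v.1 ⬝ᵥ v.1)) := by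
      let L := LinearMap.toContinuousLinearMap (Matrix.toEuclideanLin A)
      refine ⟨-‖L‖, ?_⟩
      rintro _ ⟨⟨w, hw⟩, rfl⟩
      have hw' : (WithLp.toLp 2 w : EuclideanSpace ℝ n) ≠ 0 := by simpa using hw
      have hpos : 0 < ‖(WithLp.toLp 2 w : EuclideanSpace ℝ n)‖ ^ 2 := by positivity
      show -‖L‖ ≤ (w ⬝ᵥ (A *ᵥ w)) / (w ⬝ᵥ w)
      rw [← hq w, le_div_iff₀ hpos]
      have h1 := abs_real_inner_le_norm (L (WithLp.toLp 2 w)) (WithLp.toLp 2 w)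
      have h2 := L.le_opNorm (WithLp.toLp 2 w)
      have h3 := (abs_le.mp h1).1
      have h4 : inner ℝ (L (WithLp.toLp 2 w)) (WithLp.toLp 2 w)
        = inner ℝ (Matrix.toEuclideanLin A (WithLp.toLp 2 w)) (WithLp.toLp 2 w) := rfl
      rw [← h4]
      nlinarith [norm_nonneg (WithLp.toLp 2 w : EuclideanSpace ℝ n)]
    refine (ciInf_le hbdd ⟨v, hv0⟩).trans (le_of_eq ?_)
    show (v ⬝ᵥ (A *ᵥ v)) / (v ⬝ᵥ v) = a
    rw [hAv, dotProduct_smul, smul_eq_mul, mul_div_assoc, div_self hvv, mul_one]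

/-! ### The sensing scenario -/

/-- The data of the cooperative sensing system; `ι` is the set of all receivers. -/
structure Scenario (ι : Type*) where
  /-- transmitted power -/
  E : ℝ
  /-- waveform -/
  s : ℝ → ℂ
  /-- speed of light -/
  c : ℝ
  /-- sampling period -/
  Ts : ℝ
  /-- length of the interval of transmitted samples -/
  Td : ℝ
  /-- number of samples used for the local estimates -/
  K : ℕ
  /-- position of the transmitter -/
  tx : EuclideanSpace ℝ (Fin 2)
  /-- positions of the receivers -/
  rx : ι → EuclideanSpace ℝ (Fin 2)
  /-- noise variances `σₙ²` -/
  σ2 : ι → ℝ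
  /-- estimated delays -/
  τhat : ι → ℝ
  /-- estimated effective reflecting coefficients -/
  αhat : ι → ℂ
  /-- location at which the Fisher information matrix is evaluated -/
  θhat : EuclideanSpace ℝ (Fin 2)
  /-- selected receivers -/
  Ω : Finset ι
  /-- transmit powers of the receivers -/
  P : ι → ℝ
  /-- channel gains to the fusion center -/
  g : ι → ℝ
  /-- noise power at the fusion center -/
  N₀ : ℝ
  /-- bound on the Cramér-Rao lower bound -/
  ε : ℝ
  E_pos : 0 < E
  c_pos : 0 < c
  Ts_pos : 0 < Ts
  σ2_pos : ∀ n, 0 < σ2 n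
  P_pos : ∀ n, 0 < P n
  g_pos : ∀ n, 0 < g n
  N₀_pos : 0 < N₀

namespace Scenario

variable {ι : Type*} (D : Scenario ι)

/-- The sample indices `{k ∈ ℤ | τ̂ₙ - T_d/2 ≤ k T_s ≤ τ̂ₙ + T_d/2}` (recall `T_s > 0`). -/
def samples (n : ι) : Finset ℤ :=
  Finset.Icc ⌈(D.τhat n - D.Td / 2) / D.Ts⌉ ⌊(D.τhat n + D.Td / 2) / D.Ts⌋

/-- Index set of the `2Kₙ` real samples: real parts, then imaginary parts. -/
abbrev Idx (n : ι) : Type := D.samples n ⊕ D.samples n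

/-- The real vector of the real parts and then the imaginary parts of a complex sample vector. -/
def realify (n : ι) (a : ℤ → ℂ) : D.Idx n → ℝ :=
  Sum.elim (fun k => (a k).re) (fun k => (a k).im)

/-- Cramér-Rao lower bound of the delay. -/
def crlbτ (n : ι) : ℝ :=
  1 / (2 * D.E / D.σ2 n * ‖D.αhat n‖ ^ 2 *
    ∑ k ∈ Finset.Icc 1 D.K, ‖deriv D.s (k * D.Ts - D.τhat n)‖ ^ 2)

/-- Cramér-Rao lower bound of the effective reflecting coefficient. -/
def crlbα (n : ι) : ℝ :=
  1 / (2 * D.E / D.σ2 n * ∑ k ∈ Finset.Icc 1 D.K, ‖D.s (k * D.Ts - D.τhat n)‖ ^ 2)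

def pvec (n : ι) : D.Idx n → ℝ :=
  D.realify n fun k => D.αhat n * deriv D.s (k * D.Ts - D.τhat n)

def qvec₁ (n : ι) : D.Idx n → ℝ :=
  D.realify n fun k => D.s (k * D.Ts - D.τhat n)

/-- Multiplying by the imaginary unit turns `(Re s, Im s)` into `(-Im s, Re s)`. -/
def qvec₂ (n : ι) : D.Idx n → ℝ :=
  D.realify n fun k => Complex.I * D.s (k * D.Ts - D.τhat n)

/-- Covariance matrix of the (linearised) vector of real samples at receiver `n`. -/
def Qr (n : ι) : Matrix (D.Idx n) (D.Idx n) ℝ :=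
  (D.E * D.crlbτ n) • Matrix.vecMulVec (D.pvec n) (D.pvec n)
    + (D.E * (1 / 2 * D.crlbα n)) • Matrix.vecMulVec (D.qvec₁ n) (D.qvec₁ n)
    + (D.E * (1 / 2 * D.crlbα n)) • Matrix.vecMulVec (D.qvec₂ n) (D.qvec₂ n)
    + (1 / 2 * D.σ2 n) • (1 : Matrix (D.Idx n) (D.Idx n) ℝ)

/-- Delay at receiver `n` of the echo of a target at `θ`. -/
def delay (n : ι) (θ : EuclideanSpace ℝ (Fin 2)) : ℝ :=
  (dist D.tx θ + dist (D.rx n) θ) / D.c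

/-- The noiseless real sample vector of receiver `n` for a target at `θ`. -/
def signal (n : ι) (θ : EuclideanSpace ℝ (Fin 2)) : D.Idx n → ℝ :=
  D.realify n fun k => Real.sqrt D.E * (D.αhat n * D.s (k * D.Ts - D.delay n θ))

/-- The `2 × 2Kₙ` matrix `∂sₙ/∂θ` at `θ̂`. -/
def jac (n : ι) : Matrix (Fin 2) (D.Idx n) ℝ :=
  Matrix.of fun i j =>
    fderiv ℝ (fun θ => D.signal n θ j) D.θhat (EuclideanSpace.single i (1 : ℝ))

end Scenario

/-- Eigenvalue decompositions `Q = U diag(γ) Uᵀ` of the covariance matrices of a scenario. -/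
structure KLT {ι : Type*} (D : Scenario ι) where
  U : (n : ι) → Matrix (D.Idx n) (D.Idx n) ℝ
  γ : (n : ι) → D.Idx n → ℝ
  orthogonal : ∀ n, U n ∈ Matrix.orthogonalGroup (D.Idx n) ℝ
  decomp : ∀ n, D.Qr n = U n * Matrix.diagonal (γ n) * (U n)ᵀ

/-! ### The relaxed bit-allocation problem -/

/-- Index set of the coordinates of `x = [{X_{nj}}, W, vec(M)]`. -/
abbrev Coord {ι : Type*} (D : Scenario ι) : Type _ :=
  ((n : D.Ω) × D.Idx n) ⊕ Unit ⊕ (Fin 2 × Fin 2)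

/-- The space of the variables `x = [{X_{nj}}, W, vec(M)]`, with the Euclidean norm. -/
abbrev Var {ι : Type*} (D : Scenario ι) : Type _ := EuclideanSpace ℝ (Coord D)

/-- The two ways of writing the capacity constraint of a set `S` of receivers as `f ≤ 0`:
`X(S)/W - C_S ≤ 0`, or, multiplied by `W > 0`, `X(S) - W C_S ≤ 0`. -/
inductive CapacityForm
  | ratio
  | linear

/-- Index set of the constraints: the matrix inequality, the trace constraint, and one
capacity constraint for every non-empty set of selected receivers. -/
abbrev Con {ι : Type*} (D : Scenario ι) : Type _ :=
  Unit ⊕ Unit ⊕ {S : Finset D.Ω // S.Nonempty}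

section Problem

variable {ι : Type*} {D : Scenario ι}

/-- The number of bits `X_{nj}`. -/
def bits (x : Var D) (n : D.Ω) (j : D.Idx n) : ℝ := x (Sum.inl ⟨n, j⟩)

/-- The number of channel uses `W`. -/
def uses (x : Var D) : ℝ := x (Sum.inr (Sum.inl ()))

/-- The auxiliary matrix `M`. -/
def aux (x : Var D) : Matrix (Fin 2) (Fin 2) ℝ :=
  Matrix.of fun i k => x (Sum.inr (Sum.inr (i, k)))

variable (D) in
/-- The domain `𝒳`: `X_{nj} ≥ 0`, `W > 0`, `M` symmetric. -/
def domain : Set (Var D) :=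
  {x | (∀ n j, 0 ≤ bits x n j) ∧ 0 < uses x ∧ (aux x).IsSymm}

/-- Covariance matrix `Qₙ = Uₙ diag(η) Uₙᵀ` of the quantization error at receiver `n`, where
`η_{nj} = γ_{nj} / 2^(2 X_{nj} - 1)`. -/
def quantCov (T : KLT D) (x : Var D) (n : D.Ω) : Matrix (D.Idx n) (D.Idx n) ℝ :=
  T.U n * Matrix.diagonal (fun j => T.γ n j / (2 : ℝ) ^ (2 * bits x n j - 1)) * (T.U n)ᵀ

/-- The Fisher information matrix `J(θ̂)` as a function of the bit allocation. -/
def fisher (T : KLT D) (x : Var D) : Matrix (Fin 2) (Fin 2) ℝ :=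
  ∑ n : D.Ω, D.jac n *
    ((1 / 2 * D.σ2 n) • (1 : Matrix (D.Idx n) (D.Idx n) ℝ) + quantCov T x n)⁻¹ * (D.jac n)ᵀ

/-- `y_n(X) = 2^(2X-1) / (γ_{nj} + 2^(2X-2) σₙ²)`. -/
def yfun (T : KLT D) (n : D.Ω) (j : D.Idx n) (X : ℝ) : ℝ :=
  (2 : ℝ) ^ (2 * X - 1) / (T.γ n j + (2 : ℝ) ^ (2 * X - 2) * D.σ2 n)

/-- The tangent of `y_n` at the current point `Xt`. -/
def tangent (T : KLT D) (n : D.Ω) (j : D.Idx n) (Xt X : ℝ) : ℝ :=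
  (X - Xt) * deriv (yfun T n j) Xt + yfun T n j Xt

/-- The surrogate Fisher information matrix at the current point `xt`: in
`J = ∑ₙ (∂sₙ Uₙ) diag(y_n(X_{nj})) (∂sₙ Uₙ)ᵀ`, every `y_n` is replaced by its tangent. -/
def fisherSurr (T : KLT D) (xt x : Var D) : Matrix (Fin 2) (Fin 2) ℝ :=
  ∑ n : D.Ω, (D.jac n * T.U n) *
    Matrix.diagonal (fun j => tangent T n j (bits xt n j) (bits x n j)) * (D.jac n * T.U n)ᵀ

/-- The block matrix `[M, I; I, J]`. -/
def blockMat (M J : Matrix (Fin 2) (Fin 2) ℝ) : Matrix (Fin 2 ⊕ Fin 2) (Fin 2 ⊕ Fin 2) ℝ :=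
  Matrix.fromBlocks M 1 1 J

variable (D) in
/-- The capacity `log₂(1 + ∑_{n ∈ S} Pₙ gₙ / N₀)`, in bits per channel use. -/
def capacity (S : Finset D.Ω) : ℝ :=
  Real.logb 2 (1 + (∑ n ∈ S, D.P n * D.g n) / D.N₀)

/-- The capacity constraint function of a set `S` of receivers. -/
def capacityFun (F : CapacityForm) (S : Finset D.Ω) (x : Var D) : ℝ :=
  match F with
  | .ratio => (∑ n ∈ S, (∑ j, bits x n j) / uses x) - capacity D S
  | .linear => (∑ n ∈ S, ∑ j, bits x n j) - uses x * capacity D S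

/-- The constraint functions of the relaxed problem `min W` over `domain D` subject to
`-λ_min(G) ≤ 0`, `tr M - ε ≤ 0` and the capacity constraints. -/
def con (T : KLT D) (F : CapacityForm) : Con D → Var D → ℝ
  | .inl _, x => -minEig (blockMat (aux x) (fisher T x))
  | .inr (.inl _), x => (aux x).trace - D.ε
  | .inr (.inr S), x => capacityFun F S.1 x

/-- The surrogate objective at the current point `xt`. -/
def objSurr (μ : ℝ) (xt x : Var D) : ℝ := uses x + μ * ‖x - xt‖ ^ 2

/-- The surrogate constraint functions at the current point `xt`. -/
def conSurr (T : KLT D) (F : CapacityForm) (μ : ℝ) (xt : Var D) : Con D → Var D → ℝ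
  | .inl _, x => -minEig (blockMat (aux x) (fisherSurr T xt x)) + μ * ‖x - xt‖ ^ 2
  | .inr i, x => con T F (.inr i) x + μ * ‖x - xt‖ ^ 2

/-- `x` is a sequence of MCSCA iterates: it starts at a feasible point of the relaxed problem, and
`x (t+1)` solves the surrogate problem at `x t` with the trust region `‖z - x t‖² ≤ (β t)²`. -/
def IsMCSCA (T : KLT D) (F : CapacityForm) (μ : ℝ) (β : ℕ → ℝ) (x : ℕ → Var D) : Prop :=
  IsFeasible (domain D) (con T F) (x 0) ∧
  ∀ t, IsSolution (domain D ∩ {z | ‖z - x t‖ ^ 2 ≤ β t ^ 2})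
    (objSurr μ (x t)) (conSurr T F μ (x t)) (x (t + 1))

/-- Slater's condition for the iterates `x` along a subsequence `φ`: the surrogate constraint
functions converge pointwise on the domain, and their limits are simultaneously negative at some
point of the relative interior of the domain. -/
def Slater (T : KLT D) (F : CapacityForm) (μ : ℝ) (x : ℕ → Var D) (φ : ℕ → ℕ) : Prop :=
  ∃ flim : Con D → Var D → ℝ,
    (∀ i, ∀ z ∈ domain D,
      Tendsto (fun k => conSurr T F μ (x (φ k)) i z) atTop (𝓝 (flim i z))) ∧
    ∃ z ∈ intrinsicInterior ℝ (domain D), ∀ i, flim i z < 0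

end Problem

end MCSCA

end

/-!
Replace the constraints by convex models at `x` and call `x` critical if no point of the domain
with a smaller objective satisfies all the models at `x` strictly. Under Slater's condition a
critical point has Lagrange multipliers, and since the models are exact up to a quadratic error,
their convex subgradients are Fréchet subgradients of the true constraint functions: `x` is KKT.

Limit points are critical. Near a non-critical point, a trust-region step of radius `β t` decreases
the objective by a multiple of `β t` as long as the violation of the constraints is at most a
multiple of `β t`; the violation after each step is `O(β t ^ 2)`. Since `∑ β t = ∞`, the iterates
leave a ball around the point, at the cost of a definite decrease of the objective. To come back
they would have to climb through every objective value just below the one of the limit point, which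
is impossible across a level that contains no feasible critical points.

Such levels exist because the objective values of feasible critical points form a null set.
Eliminating `M` turns these points into KKT points of a problem with analytic data (minimise `W`
subject to `tr J⁻¹ ≤ ε`, linear capacity constraints and non-negative bits). Writing the multipliers
as squares makes their objective values critical values of an analytic function, and these are null
by Sard's theorem.
-/

namespace MCSCA

/-! ### Sard's theorem for analytic functions -/

section Sard

open MeasureTheory Set
open scoped ContDiff NNReal ENNReal

section Taylor

variable {E F : Type*} [NormedAddCommGroup E] [NormedSpace ℝ E] [NormedAddCommGroup F]
  [NormedSpace ℝ F] {B : Set E} {x : E} {K : ℝ}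

theorem norm_sub_le_of_norm_fderiv_le_pow {f : E → F} {k : ℕ} (hB : StarConvex ℝ x B)
    (hK : 0 ≤ K) (hd : ∀ z ∈ B, DifferentiableAt ℝ f z)
    (hf : ∀ z ∈ B, ‖fderiv ℝ f z‖ ≤ K * ‖z - x‖ ^ k) {y : E} (hy : y ∈ B) :
    ‖f y - f x‖ ≤ K * ‖y - x‖ ^ (k + 1) := by
  have hseg : segment ℝ x y ⊆ B := hB.segment_subset hy
  have hbound : ∀ z ∈ segment ℝ x y, ‖fderiv ℝ f z‖ ≤ K * ‖y - x‖ ^ k := by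
    intro z hz
    refine (hf z (hseg hz)).trans ?_
    have := norm_sub_le_of_mem_segment hz
    gcongr
  have := (convex_segment x y).norm_image_sub_le_of_norm_fderiv_le
    (fun z hz => hd z (hseg hz)) hbound (left_mem_segment ℝ x y) (right_mem_segment ℝ x y)
  rwa [mul_assoc, ← pow_succ] at this

theorem norm_sub_le_of_iteratedFDeriv_eq_zero {f : E → F} {N : ℕ} (hB : StarConvex ℝ x B)
    (hf : ∀ y ∈ B, ContDiffAt ℝ (N + 1) f y) (hK0 : 0 ≤ K)
    (hK : ∀ y ∈ B, ‖iteratedFDeriv ℝ (N + 1) f y‖ ≤ K)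
    (h0 : ∀ j, 1 ≤ j → j ≤ N → iteratedFDeriv ℝ j f x = 0) {y : E} (hy : y ∈ B) :
    ‖f y - f x‖ ≤ K * ‖y - x‖ ^ (N + 1) := by
  have bound : ∀ k m : ℕ, m + k = N → ∀ z ∈ B,
      ‖iteratedFDeriv ℝ (m + 1) f z‖ ≤ K * ‖z - x‖ ^ k := by
    intro k
    induction k with
    | zero =>
      rintro m rfl z hz
      simpa using hK z hz
    | succ k ih =>
      intro m hm z hz
      have hd : ∀ w ∈ B, DifferentiableAt ℝ (iteratedFDeriv ℝ (m + 1) f) w := fun w hw =>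
        (hf w hw).differentiableAt_iteratedFDeriv (by exact_mod_cast (by omega : m + 1 < N + 1))
      have := norm_sub_le_of_norm_fderiv_le_pow hB hK0 hd (k := k) (fun w hw => by
        simpa only [norm_fderiv_iteratedFDeriv] using ih (m + 1) (by omega) w hw) hz
      rwa [h0 (m + 1) (by omega) (by omega), sub_zero] at this
  refine norm_sub_le_of_norm_fderiv_le_pow hB hK0
    (fun z hz => (hf z hz).differentiableAt (by simp)) (fun z hz => ?_) hy
  rw [← norm_iteratedFDeriv_one]
  exact bound N 0 (zero_add N) z hz

end Taylor

theorem volume_image_null_of_locally {E : Type*} [TopologicalSpace E] [SecondCountableTopology E]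
    {f : E → ℝ} {s : Set E} (h : ∀ x ∈ s, ∃ V ∈ 𝓝 x, volume (f '' (s ∩ V)) = 0) :
    volume (f '' s) = 0 := by
  suffices OuterMeasure.comap f volume.toOuterMeasure s = 0 by simpa using this
  refine measure_null_of_locally_null s fun x hx => ?_
  obtain ⟨V, hV, h0⟩ := h x hx
  exact ⟨s ∩ V, inter_mem self_mem_nhdsWithin (mem_nhdsWithin_of_mem_nhds hV), by simpa using h0⟩

variable {E : Type*} [NormedAddCommGroup E] [NormedSpace ℝ E]

/-- The points of `s` at which `f` is flat to order `k`: its derivatives of orders `1, …, k`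
vanish. -/
def flatSet (f : E → ℝ) (s : Set E) (k : ℕ) : Set E :=
  {x ∈ s | ∀ j, 1 ≤ j → j ≤ k → iteratedFDeriv ℝ j f x = 0}

theorem exists_analytic_vanishing_on_flatSet {f : E → ℝ} {s : Set E} {k : ℕ} (hk : 1 ≤ k) {a : E}
    (hf : ContDiffAt ℝ ω f a) (ha : a ∈ flatSet f s k \ flatSet f s (k + 1)) :
    ∃ h : E → ℝ, ContDiffAt ℝ ω h a ∧ fderiv ℝ h a ≠ 0 ∧ ∀ y ∈ flatSet f s k, h y = 0 := by
  have hne : iteratedFDeriv ℝ (k + 1) f a ≠ 0 := fun h0 =>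
    ha.2 ⟨ha.1.1, fun j h1 h2 => by
      rcases h2.lt_or_eq with h | rfl
      · exact ha.1.2 j h1 (by omega)
      · exact h0⟩
  obtain ⟨v, hv⟩ : ∃ v, iteratedFDeriv ℝ (k + 1) f a v ≠ 0 := by
    by_contra! hcon
    exact hne (ContinuousMultilinearMap.ext hcon)
  have hfk : ContDiffAt ℝ ω (iteratedFDeriv ℝ k f) a :=
    hf.iteratedFDeriv_right (m := ω) (i := k) (by simp)
  let ev := ContinuousMultilinearMap.apply ℝ (fun _ : Fin k => E) ℝ (Fin.tail v)
  have hfd : fderiv ℝ (ev ∘ iteratedFDeriv ℝ k f) a =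
      ev.comp (fderiv ℝ (iteratedFDeriv ℝ k f) a) :=
    (ev.hasFDerivAt.comp a (hfk.differentiableAt (by simp)).hasFDerivAt).fderiv
  refine ⟨ev ∘ iteratedFDeriv ℝ k f, ev.contDiff.contDiffAt.comp a hfk, fun h0 => hv ?_,
    fun y hy => by simp [ev, hy.2 k hk le_rfl]⟩
  rw [iteratedFDeriv_succ_apply_left]
  exact DFunLike.congr_fun (hfd.symm.trans h0) (v 0)

/-- Sard's theorem on the hyperplanes of `E`; the hypothesis of the induction on the dimension. -/
def SardOnHyperplanes (E : Type*) [NormedAddCommGroup E] [NormedSpace ℝ E] : Prop :=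
  ∀ L : E →L[ℝ] ℝ, L ≠ 0 → ∀ (g : L.ker → ℝ) (t : Set L.ker),
    (∀ w ∈ t, ContDiffAt ℝ ω g w) → (∀ w ∈ t, fderiv ℝ g w = 0) → volume (g '' t) = 0

variable [FiniteDimensional ℝ E]

theorem volume_image_eq_zero_of_holderOnWith {f : E → ℝ} {s : Set E} {K r : ℝ≥0}
    (hr : Module.finrank ℝ E < r) (hf : HolderOnWith K r f s) : volume (f '' s) = 0 := by
  have hr0 : 0 < r := by
    have : (0 : ℝ≥0) ≤ Module.finrank ℝ E := zero_le
    exact this.trans_lt hr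
  have hs : dimH s ≤ Module.finrank ℝ E :=
    (dimH_mono (subset_univ s)).trans_eq (Real.dimH_univ_eq_finrank E)
  have him : dimH (f '' s) < (1 : ℝ≥0) := by
    refine (hf.dimH_image_le hr0).trans_lt (ENNReal.div_lt_of_lt_mul (hs.trans_lt ?_))
    rw [ENNReal.coe_one, one_mul]
    exact_mod_cast hr
  simpa only [NNReal.coe_one, hausdorffMeasure_real] using hausdorffMeasure_of_dimH_lt him

theorem volume_image_eq_zero_of_iteratedFDeriv_eq_zero {f : E → ℝ} {s : Set E} {N : ℕ}
    (hN : Module.finrank ℝ E ≤ N) (hf : ∀ x ∈ s, ContDiffAt ℝ (N + 1) f x)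
    (h0 : ∀ x ∈ s, ∀ j, 1 ≤ j → j ≤ N → iteratedFDeriv ℝ j f x = 0) :
    volume (f '' s) = 0 := by
  have : SecondCountableTopology E := secondCountable_of_proper
  refine volume_image_null_of_locally fun x hx => ?_
  have hcont : ContinuousAt (iteratedFDeriv ℝ (N + 1) f) x :=
    ((hf x hx).iteratedFDeriv_right (m := 0) (i := N + 1) (by simp)).continuousAt
  let K : ℝ≥0 := ⟨‖iteratedFDeriv ℝ (N + 1) f x‖ + 1, by positivity⟩
  obtain ⟨r, hr, hball⟩ := Metric.eventually_nhds_iff_ball.1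
    (((hf x hx).eventually (by exact_mod_cast WithTop.natCast_ne_top (N + 1))).and
      (hcont.norm.eventually_lt_const (lt_add_one _)))
  refine ⟨Metric.ball x r, Metric.ball_mem_nhds x hr, ?_⟩
  refine volume_image_eq_zero_of_holderOnWith (K := K) (r := (N + 1 : ℕ))
    (by exact_mod_cast Nat.lt_succ_of_le hN) fun y hy z hz => ?_
  have := norm_sub_le_of_iteratedFDeriv_eq_zero ((convex_ball x r).starConvex hz.2)
    (fun w hw => (hball w hw).1) K.2 (fun w hw => (hball w hw).2.le) (h0 z hz.1) hy.2
  rw [edist_dist, edist_dist, dist_eq_norm, dist_eq_norm, ← ENNReal.ofReal_coe_nnreal,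
    NNReal.coe_natCast, ENNReal.rpow_natCast, ← ENNReal.ofReal_pow (norm_nonneg _),
    ← ENNReal.ofReal_mul K.coe_nonneg]
  exact ENNReal.ofReal_le_ofReal this

theorem exists_analytic_parametrization {h : E → ℝ} {a : E} (hh : ContDiffAt ℝ ω h a)
    (ha : h a = 0) (hd : fderiv ℝ h a ≠ 0) :
    ∃ (ψ : (fderiv ℝ h a).ker → E) (p : E → (fderiv ℝ h a).ker), ContDiffAt ℝ ω ψ (p a) ∧
      ContinuousAt p a ∧ ∀ᶠ y in 𝓝 a, h y = 0 → ψ (p y) = y := by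
  have : CompleteSpace E := FiniteDimensional.complete ℝ E
  have hrange : (fderiv ℝ h a).range = ⊤ :=
    LinearMap.range_eq_top.2 <| LinearMap.surjective fun h0 =>
      hd (ContinuousLinearMap.coe_injective h0)
  have hker : (fderiv ℝ h a).ker.ClosedComplemented :=
    (fderiv ℝ h a).ker_closedComplemented_of_finiteDimensional_range
  let φ := HasStrictFDerivAt.implicitFunctionDataOfComplemented h (fderiv ℝ h a)
    (hh.hasStrictFDerivAt (by simp)) hrange hker
  have hright : ContDiff ℝ ω φ.rightFun := by
    change ContDiff ℝ ω fun x => Classical.choose hker (x - a)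
    exact (ContinuousLinearMap.contDiff _).comp (contDiff_id.sub contDiff_const)
  have hleft : φ.leftFun = h := rfl
  refine ⟨φ.implicitFunction 0, φ.rightFun, ?_, hright.continuous.continuousAt, ?_⟩
  · have hψ := ImplicitFunctionData.contDiffAt_implicitFunction (φ := φ) hh hright.contDiffAt
      (by simp)
    have hpt : φ.prodFun φ.pt = (0, φ.rightFun a) := Prod.ext ha rfl
    rw [hpt] at hψ
    exact hψ.comp (φ.rightFun a) (contDiffAt_const.prodMk contDiffAt_id)
  · filter_upwards [φ.implicitFunction_apply_image] with y hy h0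
    rwa [hleft, h0] at hy

theorem volume_image_flatSet_sdiff_eq_zero (hE : SardOnHyperplanes E) {f : E → ℝ} {s : Set E}
    (hf : ∀ x ∈ s, ContDiffAt ℝ ω f x) (hd : ∀ x ∈ s, fderiv ℝ f x = 0) {k : ℕ} (hk : 1 ≤ k) :
    volume (f '' (flatSet f s k \ flatSet f s (k + 1))) = 0 := by
  have : SecondCountableTopology E := secondCountable_of_proper
  refine volume_image_null_of_locally fun a ha => ?_
  obtain ⟨h, hh, hh', hzero⟩ := exists_analytic_vanishing_on_flatSet hk (hf a ha.1.1) ha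
  obtain ⟨ψ, p, hψ, hp, hψp⟩ := exists_analytic_parametrization hh (hzero a ha.1) hh'
  let t : Set (fderiv ℝ h a).ker := {w | ψ w ∈ s ∧ ContDiffAt ℝ ω ψ w}
  have hnull : volume ((f ∘ ψ) '' t) = 0 := by
    refine hE _ hh' (f ∘ ψ) t (fun w hw => (hf _ hw.1).comp w hw.2) fun w hw => ?_
    rw [fderiv_comp w ((hf _ hw.1).differentiableAt (by simp))
      (hw.2.differentiableAt (by simp)), hd _ hw.1, ContinuousLinearMap.zero_comp]
  refine ⟨_, hψp.and (hp.eventually (hψ.eventually (by simp))), measure_mono_null ?_ hnull⟩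
  rintro _ ⟨y, ⟨hy, hψy, hanalytic⟩, rfl⟩
  have hyp : ψ (p y) = y := hψy (hzero y hy.1)
  exact ⟨p y, ⟨by rw [hyp]; exact hy.1.1, hanalytic⟩, by simp only [Function.comp_apply, hyp]⟩

theorem volume_image_sdiff_flatSet_eq_zero (hE : SardOnHyperplanes E) {f : E → ℝ} {s : Set E}
    (hf : ∀ x ∈ s, ContDiffAt ℝ ω f x) (hd : ∀ x ∈ s, fderiv ℝ f x = 0) (k : ℕ) :
    volume (f '' (s \ flatSet f s (k + 1))) = 0 := by
  induction k with
  | zero =>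
    have hs : s ⊆ flatSet f s 1 := fun x hx => ⟨hx, fun j h1 h2 => by
      obtain rfl : j = 1 := le_antisymm h2 h1
      rw [← norm_eq_zero, norm_iteratedFDeriv_one, hd x hx, norm_zero]⟩
    simp [Set.sdiff_eq_empty.2 hs]
  | succ k ih =>
    have hsplit : s \ flatSet f s (k + 1 + 1) ⊆
        s \ flatSet f s (k + 1) ∪ flatSet f s (k + 1) \ flatSet f s (k + 1 + 1) :=
      sdiff_triangle _ _ _
    refine measure_mono_null (image_mono hsplit) ?_
    rw [image_union]
    exact measure_union_null ih (volume_image_flatSet_sdiff_eq_zero hE hf hd (by omega))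

theorem volume_image_critical_eq_zero {f : E → ℝ} {s : Set E} (hf : ∀ x ∈ s, ContDiffAt ℝ ω f x)
    (hd : ∀ x ∈ s, fderiv ℝ f x = 0) : volume (f '' s) = 0 := by
  obtain ⟨n, hn⟩ : ∃ n, Module.finrank ℝ E = n := ⟨_, rfl⟩
  induction n generalizing E with
  | zero =>
    have : Subsingleton E := Module.finrank_zero_iff.1 hn
    exact (Set.subsingleton_of_subsingleton.image f).measure_zero _
  | succ n ih =>
    have hE : SardOnHyperplanes E := fun L hL g t hg hg' => by
      refine ih hg hg' ?_
      have := Module.Dual.finrank_ker_add_one_of_ne_zero (f := (L : E →ₗ[ℝ] ℝ))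
        fun h0 => hL (ContinuousLinearMap.coe_injective h0)
      exact Nat.succ_injective (this.trans hn)
    have hflat : volume (f '' flatSet f s (n + 1)) = 0 :=
      volume_image_eq_zero_of_iteratedFDeriv_eq_zero hn.le
        (fun x hx => (hf x hx.1).of_le le_top) fun x hx => hx.2
    refine measure_mono_null (image_mono (subset_sdiff_union s (flatSet f s (n + 1)))) ?_
    rw [image_union]
    exact measure_union_null (volume_image_sdiff_flatSet_eq_zero hE hf hd n) hflat

end Sard

/-! ### Multipliers and subgradients -/

section Convex

open Set

theorem nonneg_of_forall_pos_add_mul {a b : ℝ} (h : ∀ t : ℝ, 0 < t → 0 < a + t * b) :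
    0 ≤ a ∧ 0 ≤ b := by
  constructor
  · have hlim : Tendsto (fun t : ℝ => a + t * b) (𝓝[>] 0) (𝓝 (a + 0 * b)) :=
      ((by fun_prop : Continuous fun t : ℝ => a + t * b).tendsto 0).mono_left nhdsWithin_le_nhds
    simpa using ge_of_tendsto hlim (eventually_mem_nhdsWithin.mono fun t ht => (h t ht).le)
  · by_contra! hb
    have := h ((|a| + 1) / -b) (div_pos (by positivity) (neg_pos.2 hb))
    rw [div_mul_eq_mul_div, div_neg, mul_div_cancel_right₀ _ hb.ne] at this
    linarith [le_abs_self a]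

section Multipliers

variable {E K : Type*} {𝒳 : Set E} {h : K → E → ℝ}

/-- The open upper closure of the image of `𝒳` under `h`; separating it from the origin yields
multipliers. -/
def strictUpperImage (𝒳 : Set E) (h : K → E → ℝ) : Set (K → ℝ) :=
  {r | ∃ z ∈ 𝒳, ∀ k, h k z < r k}

theorem isOpen_strictUpperImage [Finite K] : IsOpen (strictUpperImage 𝒳 h) := by
  have : strictUpperImage 𝒳 h = ⋃ z ∈ 𝒳, ⋂ k, {r : K → ℝ | h k z < r k} := by
    ext
    simp [strictUpperImage]
  rw [this]
  exact isOpen_biUnion fun z _ => isOpen_iInter_of_finite fun k =>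
    isOpen_lt continuous_const (continuous_apply k)

variable [AddCommGroup E] [Module ℝ E]

theorem convex_strictUpperImage (h𝒳 : Convex ℝ 𝒳) (hh : ∀ k, ConvexOn ℝ 𝒳 (h k)) :
    Convex ℝ (strictUpperImage 𝒳 h) := by
  rintro r ⟨z, hz, hr⟩ r' ⟨z', hz', hr'⟩ a b ha hb hab
  exact ⟨a • z + b • z', h𝒳 hz hz' ha hb hab, fun k =>
    ((hh k).convex_strict_epigraph (x := (z, r k)) (y := (z', r' k)) ⟨hz, hr k⟩ ⟨hz', hr' k⟩
      ha hb hab).2⟩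

variable [Fintype K]

theorem exists_fritzJohn_multipliers (h𝒳 : Convex ℝ 𝒳) (hne : 𝒳.Nonempty)
    (hh : ∀ k, ConvexOn ℝ 𝒳 (h k)) (hno : ∀ z ∈ 𝒳, ∃ k, 0 ≤ h k z) :
    ∃ lam : K → ℝ, (∀ k, 0 ≤ lam k) ∧ (∃ k, 0 < lam k) ∧ ∀ z ∈ 𝒳, 0 ≤ ∑ k, lam k * h k z := by
  classical
  have h0 : (0 : K → ℝ) ∉ strictUpperImage 𝒳 h := by
    rintro ⟨z, hz, hr⟩
    obtain ⟨k, hk⟩ := hno z hz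
    exact hk.not_gt (hr k)
  obtain ⟨f, hf⟩ := geometric_hahn_banach_point_open (convex_strictUpperImage h𝒳 hh)
    isOpen_strictUpperImage h0
  rw [map_zero] at hf
  have hmem : ∀ z ∈ 𝒳, ∀ v : K → ℝ, (∀ k, 0 < v k) → 0 < f ((h · z) + v) := fun z hz v hv =>
    hf _ ⟨z, hz, fun k => lt_add_of_pos_right _ (hv k)⟩
  let lam : K → ℝ := fun k => f (Pi.single k 1)
  have hsum : ∀ r : K → ℝ, f r = ∑ k, lam k * r k := fun r => by
    conv_lhs => rw [pi_eq_sum_univ' r]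
    simp [lam, mul_comm]
  obtain ⟨z₀, hz₀⟩ := hne
  have hlam : ∀ k, 0 ≤ lam k := fun k => by
    refine (nonneg_of_forall_pos_add_mul (a := f ((h · z₀) + 1)) fun t ht => ?_).2
    have := hmem z₀ hz₀ (1 + t • Pi.single k 1) fun j => by
      by_cases hj : j = k
      · simp only [hj, Pi.add_apply, Pi.one_apply, Pi.smul_apply, Pi.single_eq_same, smul_eq_mul]
        positivity
      · simp [hj]
    rwa [← add_assoc, map_add, map_smul, smul_eq_mul] at this
  refine ⟨lam, hlam, ?_, fun z hz => ?_⟩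
  · by_contra! hcon
    have := hmem z₀ hz₀ 1 fun _ => one_pos
    rw [hsum, Finset.sum_eq_zero fun k _ => by rw [(hcon k).antisymm (hlam k), zero_mul]] at this
    exact this.false
  · rw [← hsum (h · z)]
    refine (nonneg_of_forall_pos_add_mul (b := f 1) fun t ht => ?_).1
    have := hmem z hz (t • 1) fun k => by simpa using ht
    rwa [map_add, map_smul, smul_eq_mul] at this

/-- The objective `h₀` is normalised to vanish at the solution `x`. -/
theorem exists_lagrange_multipliers {h₀ : E → ℝ} (hh₀ : ConvexOn ℝ 𝒳 h₀)
    (hh : ∀ k, ConvexOn ℝ 𝒳 (h k)) (hno : ∀ z ∈ 𝒳, h₀ z < 0 → ∃ k, 0 ≤ h k z) {z₀ : E}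
    (hz₀ : z₀ ∈ 𝒳) (hslater : ∀ k, h k z₀ < 0) {x : E} (hx : x ∈ 𝒳) (hx₀ : h₀ x = 0)
    (hxk : ∀ k, h k x ≤ 0) :
    ∃ lam : K → ℝ, (∀ k, 0 ≤ lam k) ∧ (∀ k, lam k * h k x = 0) ∧
      ∀ z ∈ 𝒳, 0 ≤ h₀ z + ∑ k, lam k * h k z := by
  obtain ⟨lam, hlam, ⟨o, ho⟩, hsum⟩ := exists_fritzJohn_multipliers (K := Option K)
    (h := fun o => o.elim h₀ h) hh₀.1 ⟨x, hx⟩ (Option.rec hh₀ hh) fun z hz => by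
      by_cases hz₀ : h₀ z < 0
      · exact (hno z hz hz₀).imp' some fun _ => id
      · exact ⟨none, not_lt.1 hz₀⟩
  simp only [Fintype.sum_option, Option.elim] at hsum
  have hnone : 0 < lam none := by
    refine (hlam none).lt_of_ne fun h0 => ?_
    obtain ⟨k, rfl⟩ : ∃ k, o = some k :=
      Option.ne_none_iff_exists'.1 fun h => ho.ne (h ▸ h0)
    refine (hsum z₀ hz₀).not_gt ?_
    rw [← h0, zero_mul, zero_add]
    exact Finset.sum_neg' (fun j _ => mul_nonpos_of_nonneg_of_nonpos (hlam _) (hslater j).le)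
      ⟨k, Finset.mem_univ k, mul_neg_of_pos_of_neg ho (hslater k)⟩
  have hterm : ∀ k, lam (some k) * h k x ≤ 0 := fun k =>
    mul_nonpos_of_nonneg_of_nonpos (hlam _) (hxk k)
  have hzero : ∀ k, lam (some k) * h k x = 0 := fun k => by
    have hx0 := hsum x hx
    rw [hx₀, mul_zero, zero_add] at hx0
    exact (Finset.sum_eq_zero_iff_of_nonpos fun k _ => hterm k).1
      (le_antisymm (Finset.sum_nonpos fun k _ => hterm k) hx0) k (Finset.mem_univ k)
  refine ⟨fun k => (lam none)⁻¹ * lam (some k),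
    fun k => mul_nonneg (inv_nonneg.2 hnone.le) (hlam _),
    fun k => by rw [mul_assoc, hzero, mul_zero], fun z hz => ?_⟩
  have := mul_nonneg (inv_nonneg.2 hnone.le) (hsum z hz)
  rwa [mul_add, inv_mul_cancel_left₀ hnone.ne', Finset.mul_sum,
    Finset.sum_congr rfl fun k _ => (mul_assoc _ _ _).symm] at this

end Multipliers

theorem exists_kkt_multipliers {E K : Type*} [AddCommGroup E] [Module ℝ E] [TopologicalSpace E]
    [Fintype K] {f' : StrongDual ℝ E} {g' : K → StrongDual ℝ E} {a : K → ℝ} (ha : ∀ k, a k ≤ 0)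
    (hno : ∀ d, (∀ k, a k + g' k d < 0) → 0 ≤ f' d) (hslater : ∃ d, ∀ k, a k + g' k d < 0) :
    ∃ lam : K → ℝ, (∀ k, 0 ≤ lam k) ∧ (∀ k, lam k * a k = 0) ∧
      ∀ d, f' d + ∑ k, lam k * g' k d = 0 := by
  have hconv : ∀ ℓ : StrongDual ℝ E, ConvexOn ℝ univ ℓ := fun ℓ =>
    ℓ.toLinearMap.convexOn convex_univ
  obtain ⟨d₀, hd₀⟩ := hslater
  obtain ⟨lam, hlam, hcs, hle⟩ := exists_lagrange_multipliers (h := fun k d => a k + g' k d)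
    (hconv f') (fun k => (convexOn_const _ convex_univ).add (hconv (g' k)))
    (fun d _ hd => by by_contra! hneg; exact hd.not_ge (hno d hneg)) (mem_univ d₀) hd₀
    (mem_univ 0) (map_zero f') fun k => by simpa using ha k
  have hcs : ∀ k, lam k * a k = 0 := by simpa using hcs
  have hnonneg : ∀ d, 0 ≤ f' d + ∑ k, lam k * g' k d := fun d => by
    simpa [mul_add, hcs] using hle d (mem_univ d)
  refine ⟨lam, hlam, hcs, fun d => (hnonneg d).antisymm' ?_⟩
  have := hnonneg (-d)
  simp only [map_neg, mul_neg, Finset.sum_neg_distrib] at this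
  linarith

theorem eventually_neg_of_hasFDerivAt {E : Type*} [NormedAddCommGroup E] [NormedSpace ℝ E]
    {g : E → ℝ} {g' : E →L[ℝ] ℝ} {x d : E} (hg : HasFDerivAt g g' x) (hx : g x ≤ 0)
    (hd : g x + g' d < 0) : ∀ᶠ s : ℝ in 𝓝[>] 0, g (x + s • d) < 0 := by
  have hslope := (hg.hasLineDerivAt d).tendsto_slope_zero_right.const_add (g x)
  filter_upwards [hslope.eventually_lt_const hd, Ioc_mem_nhdsGT one_pos] with s hs ⟨hs0, hs1⟩
  rw [smul_eq_mul, ← lt_sub_iff_add_lt', zero_sub, inv_mul_lt_iff₀ hs0] at hs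
  nlinarith

theorem exists_affine_between {E : Type*} [AddCommGroup E] [Module ℝ E] [TopologicalSpace E]
    [IsTopologicalAddGroup E] [ContinuousSMul ℝ E] {h q : E → ℝ} {𝒳 : Set E} (hne : 𝒳.Nonempty)
    (hh : ConvexOn ℝ univ h) (hcont : Continuous h) (hq : ConcaveOn ℝ 𝒳 q)
    (hle : ∀ z ∈ 𝒳, q z ≤ h z) :
    ∃ (ℓ : StrongDual ℝ E) (c : ℝ), (∀ z, ℓ z + c ≤ h z) ∧ ∀ z ∈ 𝒳, q z ≤ ℓ z + c := by
  have hA : Convex ℝ {p : E × ℝ | h p.1 < p.2} := by simpa using hh.convex_strict_epigraph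
  have hAo : IsOpen {p : E × ℝ | h p.1 < p.2} :=
    isOpen_lt (hcont.comp continuous_fst) continuous_snd
  have hdisj : Disjoint {p : E × ℝ | h p.1 < p.2} {p | p.1 ∈ 𝒳 ∧ p.2 ≤ q p.1} :=
    Set.disjoint_left.2 fun p h1 h2 => (h1.trans_le (h2.2.trans (hle p.1 h2.1))).false
  obtain ⟨f, u, hfA, hfB⟩ := geometric_hahn_banach_open hA hAo hq.convex_hypograph hdisj
  let g : StrongDual ℝ E := f.comp (ContinuousLinearMap.inl ℝ E ℝ)
  let s : ℝ := f (0, 1)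
  have hf : ∀ z r, f (z, r) = g z + r * s := fun z r => by
    have : ((z, r) : E × ℝ) = (z, 0) + r • (0, 1) := by simp
    rw [this, map_add, map_smul, smul_eq_mul]
    rfl
  have hlower : ∀ z ∈ 𝒳, u ≤ g z + q z * s := fun z hz => hf z (q z) ▸ hfB _ ⟨hz, le_rfl⟩
  have hupper : ∀ z, ∀ t > 0, g z + (h z + t) * s < u := fun z t ht =>
    hf z (h z + t) ▸ hfA (z, h z + t) (lt_add_of_pos_right _ ht)
  obtain ⟨x, hx⟩ := hne
  have hs0 : s < 0 := by
    by_contra! hs0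
    have := (hlower x hx).trans_lt' (hupper x 1 one_pos)
    nlinarith [hle x hx]
  refine ⟨(-s)⁻¹ • g, -((-s)⁻¹ * u), fun z => ?_, fun z hz => ?_⟩
  · have : g z + h z * s ≤ u := sub_nonneg.1
      (nonneg_of_forall_pos_add_mul (b := -s) fun t ht => by linarith [hupper z t ht]).1
    simp only [_root_.smul_apply, smul_eq_mul, ← sub_eq_add_neg, ← mul_sub]
    rw [inv_mul_le_iff₀ (neg_pos.2 hs0)]
    linarith
  · simp only [_root_.smul_apply, smul_eq_mul, ← sub_eq_add_neg, ← mul_sub]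
    rw [le_inv_mul_iff₀ (neg_pos.2 hs0)]
    linarith [hlower z hz]

variable {E : Type*} [NormedAddCommGroup E] [InnerProductSpace ℝ E] {x : E}

section SumRule

variable [CompleteSpace E] {h : E → ℝ} {𝒳 : Set E} {l : E}

theorem exists_subgradient_of_minimizer (hh : ConvexOn ℝ univ h) (hcont : Continuous h)
    (h𝒳 : Convex ℝ 𝒳) (hx : x ∈ 𝒳) (hmin : ∀ z ∈ 𝒳, h x ≤ h z + ⟪l, z - x⟫_ℝ) :
    ∃ ξ : E, (∀ z, h x + ⟪ξ, z - x⟫_ℝ ≤ h z) ∧ -(ξ + l) ∈ normalCone 𝒳 x := by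
  have hq : ConcaveOn ℝ 𝒳 fun z => h x - ⟪l, z - x⟫_ℝ := by
    refine ⟨h𝒳, fun z _ z' _ a b _ _ hab => le_of_eq ?_⟩
    simp only [inner_sub_right, inner_add_right, inner_smul_right, smul_eq_mul]
    linear_combination (h x + ⟪l, x⟫_ℝ) * hab
  obtain ⟨ℓ, c, hlower, hupper⟩ := exists_affine_between ⟨x, hx⟩ hh hcont hq
    fun z hz => by linarith [hmin z hz]
  have hval : h x = ℓ x + c := (by simpa using hupper x hx : h x ≤ ℓ x + c).antisymm (hlower x)
  refine ⟨(InnerProductSpace.toDual ℝ E).symm ℓ, fun z => ?_, fun z hz => ?_⟩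
  · rw [InnerProductSpace.toDual_symm_apply, map_sub]
    linarith [hlower z]
  · rw [inner_neg_left, inner_add_left, InnerProductSpace.toDual_symm_apply, map_sub]
    linarith [hupper z hz]

theorem exists_subgradient_of_mul_minimizer (hh : ConvexOn ℝ univ h) (hcont : Continuous h)
    (h𝒳 : Convex ℝ 𝒳) (hx : x ∈ 𝒳) {a : ℝ} (ha : 0 ≤ a)
    (hmin : ∀ z ∈ 𝒳, a * h x ≤ a * h z + ⟪l, z - x⟫_ℝ) :
    ∃ ξ : E, (∀ z, h x + ⟪ξ, z - x⟫_ℝ ≤ h z) ∧ -(a • ξ + l) ∈ normalCone 𝒳 x := by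
  rcases ha.eq_or_lt with rfl | ha
  · obtain ⟨ξ, hξ, -⟩ := exists_subgradient_of_minimizer (l := 0) hh hcont (convex_singleton x)
      rfl fun z hz => by simp [mem_singleton_iff.1 hz]
    refine ⟨ξ, hξ, fun z hz => ?_⟩
    simpa using hmin z hz
  · obtain ⟨ξ, hξ, hcone⟩ := exists_subgradient_of_minimizer (l := a⁻¹ • l) hh hcont h𝒳 hx
      fun z hz => by
        rw [real_inner_smul_left, ← sub_le_iff_le_add', le_inv_mul_iff₀ ha]
        linarith [hmin z hz]
    refine ⟨ξ, hξ, fun z hz => ?_⟩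
    have := mul_nonpos_of_nonneg_of_nonpos ha.le (hcone z hz)
    rwa [← real_inner_smul_left, smul_neg, smul_add, smul_inv_smul₀ ha.ne'] at this

open InnerProductSpace in
theorem exists_subgradient_of_lagrangian_nonneg {K : Type*} [Fintype K] (hh : ConvexOn ℝ univ h)
    (hcont : Continuous h) (h𝒳 : Convex ℝ 𝒳) (hx : x ∈ 𝒳) {f : StrongDual ℝ E}
    {g : K → StrongDual ℝ E} {b lam : K → ℝ} {a : ℝ} (ha : 0 ≤ a) (hhx : a * h x = 0)
    (hgx : ∀ k, lam k * (g k x - b k) = 0)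
    (hle : ∀ z ∈ 𝒳, 0 ≤ f z - f x + (a * h z + ∑ k, lam k * (g k z - b k))) :
    ∃ ξ : E, (∀ z, h x + ⟪ξ, z - x⟫_ℝ ≤ h z) ∧
      -((toDual ℝ E).symm f + (a • ξ + ∑ k, lam k • (toDual ℝ E).symm (g k))) ∈
        normalCone 𝒳 x := by
  have hg : ∀ z k, lam k * g k (z - x) = lam k * (g k z - b k) := fun z k => by
    rw [map_sub]
    linear_combination -hgx k
  obtain ⟨ξ, hξ, hcone⟩ := exists_subgradient_of_mul_minimizer hh hcont h𝒳 hx ha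
    (l := (toDual ℝ E).symm f + ∑ k, lam k • (toDual ℝ E).symm (g k)) fun z hz => by
      simp only [inner_add_left, sum_inner, real_inner_smul_left, toDual_symm_apply, hg, hhx,
        map_sub f]
      linarith [hle z hz]
  exact ⟨ξ, hξ, by rwa [add_left_comm]⟩

end SumRule

theorem mem_subdiff_of_hasFDerivAt {f : E → ℝ} {ξ : E} (hf : HasFDerivAt f (innerSL ℝ ξ) x) :
    ξ ∈ subdiff f x := by
  intro ε hε
  filter_upwards [hf.isLittleO.def hε] with z hz
  rw [Real.norm_eq_abs, abs_le, innerSL_apply_apply] at hz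
  linarith [hz.1]

theorem mem_subdiff_of_sq_minorant {f h : E → ℝ} {ξ : E} {C : ℝ} (hx : f x = h x)
    (hfh : ∀ z, h z - C * ‖z - x‖ ^ 2 ≤ f z) (hξ : ∀ z, h x + ⟪ξ, z - x⟫_ℝ ≤ h z) :
    ξ ∈ subdiff f x := by
  intro ε hε
  have hlim : Tendsto (fun z => C * ‖z - x‖) (𝓝 x) (𝓝 0) := by
    have : Continuous fun z => C * ‖z - x‖ := by fun_prop
    simpa using this.tendsto x
  filter_upwards [hlim.eventually_lt_const hε] with z hz
  have hsq : C * ‖z - x‖ ^ 2 ≤ ε * ‖z - x‖ := by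
    rw [sq, ← mul_assoc]
    exact mul_le_mul_of_nonneg_right hz.le (norm_nonneg _)
  rw [hx]
  linarith [hfh z, hξ z]

theorem exists_mem_subdiff_of_mul_eventuallyEq [CompleteSpace E] {f g s : E → ℝ}
    {g' s' : E →L[ℝ] ℝ} (hg : HasFDerivAt g g' x) (hs : HasFDerivAt s s' x) (hsx : s x ≠ 0)
    (hf : s * f =ᶠ[𝓝 x] g) {l : ℝ} (hl : l * g x = 0) :
    ∃ ξ ∈ subdiff f x, (s x * l) • ξ = l • (InnerProductSpace.toDual ℝ E).symm g' := by
  have hquot : HasFDerivAt f ((s x)⁻¹ • g' - (g x / s x ^ 2) • s') x := by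
    have hinv := (hasDerivAt_inv hsx).comp_hasFDerivAt x hs
    refine ((hg.mul hinv).congr_fderiv ?_).congr_of_eventuallyEq ?_
    · simp only [Function.comp_apply]
      module
    · filter_upwards [hf, hs.continuousAt.eventually_ne hsx] with z hz hsz
      simp [← hz, hsz, mul_comm]
  have hzero : s x * l * (g x / s x ^ 2) = 0 := by
    rw [mul_div_assoc', mul_assoc, hl, mul_zero, zero_div]
  refine ⟨(InnerProductSpace.toDual ℝ E).symm ((s x)⁻¹ • g' - (g x / s x ^ 2) • s'),
    mem_subdiff_of_hasFDerivAt (hquot.congr_fderiv ?_), ?_⟩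
  · ext w
    simp
  · simp [smul_sub, smul_smul, hzero, mul_right_comm _ l, hsx]

end Convex

section KKTValues

open MeasureTheory
open scoped ContDiff

variable {E K : Type*} [NormedAddCommGroup E] [NormedSpace ℝ E] [Fintype K] {f : E → ℝ}
  {g : K → E → ℝ} {x : E}

/-- The Lagrangian with squared multipliers. Squaring removes the sign condition, and stationarity
in the multipliers is complementary slackness, so KKT points become critical points. -/
def sqLagrangian (f : E → ℝ) (g : K → E → ℝ) (p : E × (K → ℝ)) : ℝ :=
  f p.1 + ∑ k, p.2 k ^ 2 * g k p.1

theorem contDiffAt_sqLagrangian {n : WithTop ℕ∞} (hf : ContDiffAt ℝ n f x)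
    (hg : ∀ k, ContDiffAt ℝ n (g k) x) (c : K → ℝ) :
    ContDiffAt ℝ n (sqLagrangian f g) (x, c) := by
  have hfst : ContDiffAt ℝ n Prod.fst (x, c) := contDiffAt_fst
  have hcoord : ∀ k, ContDiffAt ℝ n (fun p : E × (K → ℝ) => p.2 k) (x, c) := fun k =>
    ((contDiff_apply ℝ ℝ k).comp contDiff_snd).contDiffAt
  exact (hf.comp (x, c) hfst).add (ContDiffAt.sum fun k _ =>
    ((hcoord k).pow 2).mul ((hg k).comp (x, c) hfst))

theorem hasFDerivAt_sqLagrangian {f' : E →L[ℝ] ℝ} {g' : K → E →L[ℝ] ℝ} (hf : HasFDerivAt f f' x)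
    (hg : ∀ k, HasFDerivAt (g k) (g' k) x) (c : K → ℝ) :
    HasFDerivAt (sqLagrangian f g)
      ((f' + ∑ k, c k ^ 2 • g' k).comp (ContinuousLinearMap.fst ℝ E (K → ℝ)) +
        ∑ k, (2 * (c k * g k x)) • (ContinuousLinearMap.proj k).comp
          (ContinuousLinearMap.snd ℝ E (K → ℝ))) (x, c) := by
  have hfst : HasFDerivAt Prod.fst (ContinuousLinearMap.fst ℝ E (K → ℝ)) (x, c) :=
    hasFDerivAt_fst
  have hcoord : ∀ k, HasFDerivAt (fun p : E × (K → ℝ) => p.2 k)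
      ((ContinuousLinearMap.proj k).comp (ContinuousLinearMap.snd ℝ E (K → ℝ))) (x, c) := fun k =>
    ((ContinuousLinearMap.proj k).comp (ContinuousLinearMap.snd ℝ E (K → ℝ))).hasFDerivAt
  refine ((HasFDerivAt.comp (x, c) (by exact hf) hfst).add (HasFDerivAt.fun_sum fun k _ =>
    ((hcoord k).pow 2).mul (HasFDerivAt.comp (x, c) (by exact hg k) hfst))).congr_fderiv ?_
  refine ContinuousLinearMap.ext fun p => ?_
  have hsum : ∑ k, g k x * (2 * c k * p.2 k) = ∑ k, 2 * (c k * g k x) * p.2 k :=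
    Finset.sum_congr rfl fun k _ => by ring
  simp [Finset.sum_add_distrib, add_assoc, hsum]

theorem volume_image_kkt_eq_zero [FiniteDimensional ℝ E] {s : Set E}
    (hf : ∀ x ∈ s, ContDiffAt ℝ ω f x) (hg : ∀ x ∈ s, ∀ k, ContDiffAt ℝ ω (g k) x)
    (hs : ∀ x ∈ s, ∃ lam : K → ℝ, (∀ k, 0 ≤ lam k) ∧ (∀ k, lam k * g k x = 0) ∧
      fderiv ℝ f x + ∑ k, lam k • fderiv ℝ (g k) x = 0) :
    volume (f '' s) = 0 := by
  refine measure_mono_null ?_ (volume_image_critical_eq_zero (f := sqLagrangian f g)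
    (s := {p | p.1 ∈ s ∧ fderiv ℝ (sqLagrangian f g) p = 0})
    (fun p hp => contDiffAt_sqLagrangian (hf _ hp.1) (hg _ hp.1) p.2) fun p hp => hp.2)
  rintro _ ⟨x, hx, rfl⟩
  obtain ⟨lam, hlam, hslack, hstat⟩ := hs x hx
  have hsqrt : ∀ k, √(lam k) ^ 2 = lam k := fun k => Real.sq_sqrt (hlam k)
  have hslack' : ∀ k, √(lam k) * g k x = 0 := fun k =>
    (mul_eq_zero.1 (hslack k)).elim (fun h => by simp [h]) fun h => by simp [h]
  refine ⟨(x, fun k => √(lam k)), ⟨hx, ?_⟩, ?_⟩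
  · rw [(hasFDerivAt_sqLagrangian ((hf x hx).differentiableAt (by simp)).hasFDerivAt
      (fun k => ((hg x hx k).differentiableAt (by simp)).hasFDerivAt) _).fderiv]
    simp [hsqrt, hslack', hstat]
  · simp [sqLagrangian, hsqrt, hslack]

end KKTValues

/-! ### Smallest eigenvalues and Schur complements -/

section MinEig

open scoped Matrix.Norms.L2Operator

variable {n : Type*} [Fintype n]

theorem dotProduct_self_pos {v : n → ℝ} (hv : v ≠ 0) : 0 < v ⬝ᵥ v :=
  Matrix.dotProduct_self_star_pos_iff.2 hv

theorem abs_dotProduct_mulVec_le [DecidableEq n] (A : Matrix n n ℝ) (v : n → ℝ) :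
    |v ⬝ᵥ (A *ᵥ v)| ≤ ‖A‖ * (v ⬝ᵥ v) := by
  let x : EuclideanSpace ℝ n := WithLp.toLp 2 v
  have hx : v ⬝ᵥ v = ‖x‖ * ‖x‖ := by
    rw [← real_inner_self_eq_norm_mul_norm, EuclideanSpace.inner_eq_star_dotProduct]
    simp [x]
  have hAx : v ⬝ᵥ (A *ᵥ v) = ⟪Matrix.toEuclideanCLM (n := n) (𝕜 := ℝ) A x, x⟫_ℝ := by
    rw [EuclideanSpace.inner_eq_star_dotProduct]
    simp [x]
  rw [hAx, hx, ← mul_assoc]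
  refine (abs_real_inner_le_norm _ _).trans (mul_le_mul_of_nonneg_right ?_ (norm_nonneg x))
  exact (ContinuousLinearMap.le_opNorm _ _).trans_eq (by rw [Matrix.l2_opNorm_toEuclideanCLM])

variable [Nonempty n]

theorem le_minEig_iff {A : Matrix n n ℝ} {c : ℝ} :
    c ≤ minEig A ↔ ∀ v : n → ℝ, c * (v ⬝ᵥ v) ≤ v ⬝ᵥ (A *ᵥ v) := by
  classical
  have hbdd : BddBelow (Set.range fun v : {v : n → ℝ // v ≠ 0} =>
      (v.1 ⬝ᵥ (A *ᵥ v.1)) / (v.1 ⬝ᵥ v.1)) := by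
    refine ⟨-‖A‖, ?_⟩
    rintro _ ⟨⟨v, hv⟩, rfl⟩
    simp only
    rw [le_div_iff₀ (dotProduct_self_pos hv), neg_mul]
    exact (abs_le.1 (abs_dotProduct_mulVec_le A v)).1
  have : Nonempty {v : n → ℝ // v ≠ 0} := nonempty_subtype.2 (exists_ne 0)
  rw [minEig, le_ciInf_iff hbdd]
  constructor
  · intro h v
    by_cases hv : v = 0
    · simp [hv]
    · exact (le_div_iff₀ (dotProduct_self_pos hv)).1 (h ⟨v, hv⟩)
  · rintro h ⟨v, hv⟩
    exact (le_div_iff₀ (dotProduct_self_pos hv)).2 (h v)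

theorem minEig_mul_le (A : Matrix n n ℝ) (v : n → ℝ) :
    minEig A * (v ⬝ᵥ v) ≤ v ⬝ᵥ (A *ᵥ v) :=
  le_minEig_iff.1 le_rfl v

theorem minEig_le_add_norm_sub [DecidableEq n] (A B : Matrix n n ℝ) :
    minEig A ≤ minEig B + ‖A - B‖ := by
  rw [← sub_le_iff_le_add, le_minEig_iff]
  intro v
  have hsub := (abs_le.1 (abs_dotProduct_mulVec_le (A - B) v)).2
  rw [Matrix.sub_mulVec, dotProduct_sub] at hsub
  linarith [minEig_mul_le A v]

theorem abs_minEig_sub_minEig_le [DecidableEq n] (A B : Matrix n n ℝ) :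
    |minEig A - minEig B| ≤ ‖A - B‖ := by
  rw [abs_sub_le_iff, sub_le_iff_le_add', sub_le_iff_le_add']
  exact ⟨minEig_le_add_norm_sub A B, norm_sub_rev A B ▸ minEig_le_add_norm_sub B A⟩

theorem continuous_minEig : Continuous (minEig : Matrix n n ℝ → ℝ) := by
  classical
  exact (LipschitzWith.of_dist_le_mul (K := 1) fun A B => by
    rw [NNReal.coe_one, one_mul, Real.dist_eq, dist_eq_norm]
    exact abs_minEig_sub_minEig_le A B).continuous

theorem concaveOn_minEig : ConcaveOn ℝ Set.univ (minEig : Matrix n n ℝ → ℝ) := by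
  refine ⟨convex_univ, fun A _ B _ a b ha hb _ => le_minEig_iff.2 fun v => ?_⟩
  rw [Matrix.add_mulVec, Matrix.smul_mulVec, Matrix.smul_mulVec, dotProduct_add, dotProduct_smul,
    dotProduct_smul]
  simp only [smul_eq_mul]
  have hA := mul_le_mul_of_nonneg_left (minEig_mul_le A v) ha
  have hB := mul_le_mul_of_nonneg_left (minEig_mul_le B v) hb
  linarith

theorem minEig_nonneg_iff_posSemidef {A : Matrix n n ℝ} (hA : A.IsSymm) :
    0 ≤ minEig A ↔ A.PosSemidef := by
  simp [Matrix.posSemidef_iff_dotProduct_mulVec, Matrix.isHermitian_iff_isSymm, hA, le_minEig_iff]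

theorem minEig_pos_iff_posDef {A : Matrix n n ℝ} (hA : A.IsSymm) :
    0 < minEig A ↔ A.PosDef := by
  classical
  refine ⟨fun h => Matrix.PosDef.of_dotProduct_mulVec_pos (Matrix.isHermitian_iff_isSymm.2 hA)
    fun v hv => (mul_pos h (dotProduct_self_pos hv)).trans_le (minEig_mul_le A v), fun h => ?_⟩
  obtain ⟨v, hv⟩ := (isLeast_minEig A hA).1.exists_hasEigenvector
  have hAv : A *ᵥ v = minEig A • v := by simpa using hv.apply_eq_smul
  have hpos := h.dotProduct_mulVec_pos hv.2
  rw [star_trivial, hAv, dotProduct_smul, smul_eq_mul] at hpos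
  exact pos_of_mul_pos_left hpos (dotProduct_self_pos hv.2).le

theorem abs_minEig_fromBlocks_sub_le {m : Type*} [Fintype m] [DecidableEq n] (M : Matrix m m ℝ)
    (B : Matrix m n ℝ) (C : Matrix n m ℝ) (J J' : Matrix n n ℝ) :
    |minEig (Matrix.fromBlocks M B C J) - minEig (Matrix.fromBlocks M B C J')| ≤ ‖J - J'‖ := by
  have hle : ∀ J J' : Matrix n n ℝ,
      minEig (Matrix.fromBlocks M B C J) - ‖J - J'‖ ≤ minEig (Matrix.fromBlocks M B C J') := by
    refine fun J J' => le_minEig_iff.2 fun v => ?_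
    obtain ⟨v₁, v₂, rfl⟩ : ∃ v₁ v₂, Sum.elim v₁ v₂ = v := ⟨_, _, Sum.elim_comp_inl_inr v⟩
    have hmin := minEig_mul_le (Matrix.fromBlocks M B C J) (Sum.elim v₁ v₂)
    have hsub := (abs_le.1 (abs_dotProduct_mulVec_le (J - J') v₂)).2
    have hnonneg := mul_nonneg (norm_nonneg (J - J')) (dotProduct_self_star_nonneg v₁)
    simp only [Matrix.fromBlocks_mulVec, Sum.elim_comp_inl, Sum.elim_comp_inr,
      Matrix.sub_mulVec, dotProduct_add, dotProduct_sub,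
      sumElim_dotProduct_sumElim, star_trivial] at *
    linarith
  rw [abs_sub_le_iff]
  exact ⟨by linarith [hle J J'], by linarith [hle J' J, norm_sub_rev J J']⟩

theorem minEig_add_smul_one_nonneg [DecidableEq n] {A : Matrix n n ℝ} {c : ℝ} (h : -c ≤ minEig A) :
    0 ≤ minEig (A + c • 1) := by
  refine le_minEig_iff.2 fun v => ?_
  rw [Matrix.add_mulVec, Matrix.smul_mulVec, Matrix.one_mulVec, dotProduct_add, dotProduct_smul,
    smul_eq_mul]
  linarith [le_minEig_iff.1 h v]

end MinEig

section Schur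

variable {n : Type*} [Fintype n]

theorem abs_apply_le_trace_of_posSemidef {A : Matrix n n ℝ} (hA : A.PosSemidef) (i j : n) :
    |A i j| ≤ A.trace := by
  classical
  have hdiag : ∀ k, A k k ≤ A.trace := fun k =>
    Finset.single_le_sum (f := fun k => A k k) (fun _ _ => hA.diag_nonneg) (Finset.mem_univ k)
  have hsymm : A j i = A i j := by simpa using hA.isHermitian.apply i j
  have hquad : ∀ s : ℝ, 0 ≤ A i i + 2 * s * A i j + s ^ 2 * A j j := fun s => by
    have := hA.dotProduct_mulVec_nonneg (Pi.single i 1 + Pi.single j s)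
    simp [Matrix.mulVec_add, hsymm] at this
    linarith
  rw [abs_le]
  constructor <;> linarith [hquad 1, hquad (-1), hdiag i, hdiag j]

variable [DecidableEq n] {M J : Matrix n n ℝ}

theorem posDef_of_posSemidef_fromBlocks (h : (Matrix.fromBlocks M 1 1 J).PosSemidef) :
    J.PosDef := by
  have hJ : J.PosSemidef := h.submatrix (Sum.inr : n → n ⊕ n)
  refine hJ.posDef_iff_isUnit.2 (Matrix.mulVec_injective_iff_isUnit.1 ?_)
  refine (injective_iff_map_eq_zero (Matrix.mulVecLin J)).2 fun v hv => ?_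
  rw [Matrix.mulVecLin_apply] at hv
  have := (h.dotProduct_mulVec_zero_iff (Sum.elim 0 v)).1 (by simp [Matrix.fromBlocks_mulVec, hv])
  simpa [Matrix.fromBlocks_mulVec, hv, funext_iff] using this

theorem posSemidef_fromBlocks_one_iff (hJ : J.PosDef) :
    (Matrix.fromBlocks M 1 1 J).PosSemidef ↔ (M - J⁻¹).PosSemidef := by
  have := hJ.isUnit.invertible
  simpa using Matrix.PosDef.fromBlocks₂₂ M 1 hJ

theorem trace_inv_le_of_posSemidef_fromBlocks (h : (Matrix.fromBlocks M 1 1 J).PosSemidef) :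
    J⁻¹.trace ≤ M.trace := by
  have := ((posSemidef_fromBlocks_one_iff (posDef_of_posSemidef_fromBlocks h)).1 h).trace_nonneg
  rwa [Matrix.trace_sub, sub_nonneg] at this

theorem posDef_fromBlocks_inv_add_smul (hJ : J.PosDef) {κ : ℝ} (hκ : 0 < κ) :
    (Matrix.fromBlocks (J⁻¹ + κ • 1) 1 1 J).PosDef := by
  have := hJ.isUnit.invertible
  have hpsd : (Matrix.fromBlocks (J⁻¹ + κ • 1) 1 1 J).PosSemidef := by
    rw [posSemidef_fromBlocks_one_iff hJ, add_sub_cancel_left]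
    exact Matrix.PosSemidef.one.smul hκ.le
  rw [hpsd.posDef_iff_isUnit, Matrix.isUnit_iff_isUnit_det, Matrix.det_fromBlocks₂₂]
  simp [Matrix.invOf_eq_nonsing_inv, hJ.det_pos.ne', hκ.ne']

end Schur

section InverseDerivative

open scoped Matrix.Norms.L2Operator ContDiff

variable {n : Type*} [Fintype n] [DecidableEq n] {E : Type*} [NormedAddCommGroup E]
  [NormedSpace ℝ E] {J : E → Matrix n n ℝ} {x : E}

theorem contDiffAt_trace_inv {k : WithTop ℕ∞} (hJ : ContDiffAt ℝ k J x) (hx : IsUnit (J x)) :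
    ContDiffAt ℝ k (fun y => (J y)⁻¹.trace) x := by
  obtain ⟨u, hu⟩ := hx
  have hinv : ContDiffAt ℝ k (fun A : Matrix n n ℝ => A⁻¹) (J x) := by
    simp only [Matrix.nonsing_inv_eq_ringInverse]
    exact hu ▸ contDiffAt_ringInverse ℝ u
  exact (LinearMap.toContinuousLinearMap (Matrix.traceLinearMap n ℝ ℝ)).contDiff.contDiffAt.comp x
    (hinv.comp x hJ)

theorem hasFDerivAt_trace_inv {J' : E →L[ℝ] Matrix n n ℝ} (hJ : HasFDerivAt J J' x)
    (hx : IsUnit (J x)) :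
    HasFDerivAt (fun y => (J y)⁻¹.trace)
      ((LinearMap.toContinuousLinearMap (Matrix.traceLinearMap n ℝ ℝ)).comp
        ((-ContinuousLinearMap.mulLeftRight ℝ (Matrix n n ℝ) (J x)⁻¹ (J x)⁻¹).comp J')) x := by
  obtain ⟨u, hu⟩ := hx
  have hinv : HasFDerivAt (fun A : Matrix n n ℝ => A⁻¹)
      (-ContinuousLinearMap.mulLeftRight ℝ (Matrix n n ℝ) (J x)⁻¹ (J x)⁻¹) (J x) := by
    simp only [Matrix.nonsing_inv_eq_ringInverse]
    rw [← hu, Ring.inverse_unit]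
    exact hasFDerivAt_ringInverse u
  exact (LinearMap.toContinuousLinearMap (Matrix.traceLinearMap n ℝ ℝ)).hasFDerivAt.comp x
    (hinv.comp x hJ)

end InverseDerivative

/-! ### Successive convex approximation with shrinking trust regions -/

section Decrease

variable {E : Type*} [SeminormedAddCommGroup E] {x : ℕ → E} {y : E} {β Φ : ℕ → ℝ} {r c : ℝ}
  {t₀ : ℕ}

theorem le_sub_mul_sum_of_decrease (hstep : ∀ t, ‖x (t + 1) - x t‖ ≤ β t)
    (hdec : ∀ t ≥ t₀, ‖x t - y‖ < r → Φ (t + 1) ≤ Φ t - c * β t) {k : ℕ}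
    (hk : ∀ j < k, ‖x (t₀ + j) - y‖ < r) :
    Φ (t₀ + k) ≤ Φ t₀ - c * ∑ j ∈ Finset.range k, β (t₀ + j) ∧
      ‖x (t₀ + k) - x t₀‖ ≤ ∑ j ∈ Finset.range k, β (t₀ + j) := by
  induction k with
  | zero => simp
  | succ k ih =>
    obtain ⟨hΦ, hdist⟩ := ih fun j hj => hk j (by lia)
    rw [Finset.sum_range_succ, ← add_assoc]
    refine ⟨by linarith [hdec (t₀ + k) (by lia) (hk k (by lia))], ?_⟩
    linarith [norm_sub_le_norm_sub_add_norm_sub (x (t₀ + k + 1)) (x (t₀ + k)) (x t₀),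
      hstep (t₀ + k)]

theorem exists_le_sub_of_decrease (hc : 0 < c)
    (hβ_sum : Tendsto (fun m => ∑ t ∈ Finset.range m, β t) atTop atTop)
    (hstep : ∀ t, ‖x (t + 1) - x t‖ ≤ β t) (hΦ : ∀ t, 0 ≤ Φ t) (h₀ : ‖x t₀ - y‖ < r / 2)
    (hdec : ∀ t ≥ t₀, ‖x t - y‖ < r → Φ (t + 1) ≤ Φ t - c * β t) :
    ∃ t ≥ t₀, Φ t ≤ Φ t₀ - c * (r / 2) := by
  have hexit : ∃ k, r ≤ ‖x (t₀ + k) - y‖ := by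
    by_contra! hstay
    obtain ⟨m, hm, hm'⟩ := ((hβ_sum.eventually_gt_atTop
      (Φ t₀ / c + ∑ t ∈ Finset.range t₀, β t)).and (eventually_ge_atTop t₀)).exists
    obtain ⟨k, rfl⟩ := Nat.exists_eq_add_of_le hm'
    have hdecr := (le_sub_mul_sum_of_decrease hstep hdec (k := k) fun j _ => hstay j).1
    rw [Finset.sum_range_add, ← sub_lt_iff_lt_add'] at hm
    have hbig : Φ t₀ < c * ∑ j ∈ Finset.range k, β (t₀ + j) :=
      (div_lt_iff₀' hc).1 (by linarith)
    linarith [hΦ (t₀ + k)]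
  classical
  obtain ⟨hdecr, hdist⟩ := le_sub_mul_sum_of_decrease hstep hdec (k := Nat.find hexit)
    fun j hj => not_le.1 (Nat.find_min hexit hj)
  have hmoved : r / 2 ≤ ‖x (t₀ + Nat.find hexit) - x t₀‖ := by
    linarith [Nat.find_spec hexit,
      norm_sub_le_norm_sub_add_norm_sub (x (t₀ + Nat.find hexit)) (x t₀) y]
  refine ⟨t₀ + Nat.find hexit, by lia, hdecr.trans (sub_le_sub_left ?_ _)⟩
  exact mul_le_mul_of_nonneg_left (hmoved.trans hdist) hc.le

end Decrease

section Violation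

variable {E I : Type*} [Fintype I]

/-- The largest violation of the constraints `g x i x ≤ 0`. -/
noncomputable def violation (g : E → I → E → ℝ) (x : E) : ℝ := ‖fun i => max 0 (g x i x)‖

theorem violation_nonneg (g : E → I → E → ℝ) (x : E) : 0 ≤ violation g x := norm_nonneg _

theorem le_violation (g : E → I → E → ℝ) (x : E) (i : I) : g x i x ≤ violation g x :=
  ((le_max_right _ _).trans (le_abs_self _)).trans
    (norm_le_pi_norm (fun i => max 0 (g x i x)) i)

theorem violation_le {g : E → I → E → ℝ} {x : E} {a : ℝ} (ha : 0 ≤ a) (h : ∀ i, g x i x ≤ a) :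
    violation g x ≤ a :=
  (pi_norm_le_iff_of_nonneg ha).2 fun i => by
    rw [Real.norm_of_nonneg (le_max_left _ _)]
    exact max_le ha (h i)

end Violation

section Model

variable {E I : Type*} [NormedAddCommGroup E] [InnerProductSpace ℝ E]

/-- `x` is critical for the constraint models `g x i` at `x` if no point of `𝒳` has a smaller
objective value and satisfies the constraints `g x i < 0`. -/
def IsCritical (𝒳 : Set E) (f₀ : E → ℝ) (g : E → I → E → ℝ) (x : E) : Prop :=
  ∀ z ∈ 𝒳, f₀ z < f₀ x → ∃ i, 0 ≤ g x i z

/-- A family of convex models `g x i` of the constraints at the points `x`, for a positive linear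
objective `f₀` with bounded sublevel sets. The value `g x i x` plays the role of the `i`-th
constraint function at `x`, and `𝒳` need only be closed inside `{0 < f₀}`. -/
structure IsConvexModel (𝒳 : Set E) (f₀ : E →L[ℝ] ℝ) (g : E → I → E → ℝ) : Prop where
  convex : Convex ℝ 𝒳
  convexOn : ∀ x i, ConvexOn ℝ 𝒳 (g x i)
  continuous : ∀ i, Continuous fun p : E × E => g p.1 i p.2
  pos : ∀ z ∈ 𝒳, 0 < f₀ z
  mem_of_mem_closure : ∀ z ∈ closure 𝒳, 0 < f₀ z → z ∈ 𝒳
  exists_norm_le : ∀ B, ∃ R, ∀ z ∈ 𝒳, (∀ i, g z i z ≤ 1) → f₀ z ≤ B → ‖z‖ ≤ R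

/-- What the convergence proof needs to know about trust-region iterates with radii `β t`: up to
errors of order `(β t)²`, each iterate satisfies the constraints and is at least as good as
any point of the trust region that satisfies the models of the constraints. -/
structure IsTrustRegionDescent (𝒳 : Set E) (f₀ : E →L[ℝ] ℝ) (g : E → I → E → ℝ) (β : ℕ → ℝ)
    (x : ℕ → E) : Prop where
  mem : ∀ t, x t ∈ 𝒳
  norm_sub_le : ∀ t, ‖x (t + 1) - x t‖ ≤ β t
  exists_model_le : ∃ C ≥ 0, ∀ t i, g (x (t + 1)) i (x (t + 1)) ≤ C * β t ^ 2
  exists_objective_le : ∀ B, ∃ M, ∀ t, ∀ z ∈ 𝒳, ‖z - x t‖ ≤ β t → f₀ z ≤ B →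
    (∀ i, g (x t) i z + M * β t ^ 2 ≤ 0) → f₀ (x (t + 1)) ≤ f₀ z + M * β t ^ 2

variable {𝒳 : Set E} {f₀ : E →L[ℝ] ℝ} {g : E → I → E → ℝ} {β : ℕ → ℝ} {x : ℕ → E} {y : E}

theorem IsConvexModel.exists_margin [Finite I] (hg : IsConvexModel 𝒳 f₀ g)
    (hy : ¬IsCritical 𝒳 f₀ g y) :
    ∃ z ∈ 𝒳, ∃ c > 0, ∀ᶠ w in 𝓝 y, f₀ z < f₀ w - c ∧ ∀ i, g w i z < -c := by
  simp only [IsCritical, not_forall, not_exists, not_le] at hy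
  obtain ⟨z, hz, hzy, hneg⟩ := hy
  have hmargin : ∀ᶠ c in 𝓝[>] (0 : ℝ), f₀ z < f₀ y - c ∧ ∀ i, g y i z < -c := by
    refine eventually_nhdsWithin_of_eventually_nhds
      (Eventually.and ?_ (eventually_all.2 fun i => ?_))
    · exact (continuous_const.sub continuous_id).continuousAt.eventually_const_lt
        (by simpa using hzy)
    · exact continuous_neg.continuousAt.eventually_const_lt (by simpa using hneg i)
  obtain ⟨c, ⟨hfc, hgc⟩, hc⟩ := (hmargin.and self_mem_nhdsWithin).exists
  have hcont : ∀ i, Continuous fun w => g w i z := fun i =>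
    (hg.continuous i).comp (continuous_id.prodMk continuous_const)
  exact ⟨z, hz, c, hc, ((f₀.continuous.sub continuous_const).continuousAt.eventually_const_lt
    hfc).and (eventually_all.2 fun i => (hcont i).continuousAt.eventually_lt_const (hgc i))⟩

theorem IsTrustRegionDescent.radius_nonneg (hx : IsTrustRegionDescent 𝒳 f₀ g β x) (t : ℕ) :
    0 ≤ β t :=
  (norm_nonneg _).trans (hx.norm_sub_le t)

theorem IsTrustRegionDescent.objective_le_add (hx : IsTrustRegionDescent 𝒳 f₀ g β x) (t : ℕ) :
    f₀ (x (t + 1)) ≤ f₀ (x t) + ‖f₀‖ * β t := by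
  have hdiff := (le_abs_self _).trans (f₀.le_opNorm_of_le (hx.norm_sub_le t))
  rw [map_sub] at hdiff
  linarith

variable [Fintype I]

/-- The exact penalty function whose weight makes a violation above `c * β` outweigh a step of
length `β`. -/
noncomputable def merit (f₀ : E →L[ℝ] ℝ) (g : E → I → E → ℝ) (c : ℝ) (x : E) : ℝ :=
  f₀ x + (‖f₀‖ + c) / c * violation g x

theorem le_merit {c : ℝ} (hc : 0 ≤ c) (x : E) : f₀ x ≤ merit f₀ g c x :=
  le_add_of_nonneg_right (mul_nonneg (by positivity) (violation_nonneg g x))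

theorem IsConvexModel.exists_step (hg : IsConvexModel 𝒳 f₀ g) {w z : E} (hw : w ∈ 𝒳) (hz : z ∈ 𝒳)
    {R b c : ℝ} (hR : 0 < R) (hzw : ‖z - w‖ ≤ R) (hb : 0 ≤ b) (hbR : b ≤ R)
    (hfz : f₀ z ≤ f₀ w - c) (hgz : ∀ i, g w i z ≤ -c) :
    ∃ p ∈ 𝒳, ‖p - w‖ ≤ b ∧ f₀ p ≤ f₀ w - c / R * b ∧ ∀ i, g w i p ≤ violation g w - c / R * b := by
  have hs₀ : 0 ≤ b / R := by positivity
  have hs₁ : b / R ≤ 1 := (div_le_one hR).2 hbR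
  have hcb : c / R * b = b / R * c := by ring
  refine ⟨(1 - b / R) • w + (b / R) • z, hg.convex hw hz (by linarith) hs₀ (by ring), ?_, ?_,
    fun i => ?_⟩
  · have hdiff : (1 - b / R) • w + (b / R) • z - w = (b / R) • (z - w) := by module
    rw [hdiff, norm_smul, Real.norm_of_nonneg hs₀]
    calc b / R * ‖z - w‖ ≤ b / R * R := mul_le_mul_of_nonneg_left hzw hs₀
      _ = b := div_mul_cancel₀ b hR.ne'
  · rw [map_add, map_smul, map_smul, smul_eq_mul, smul_eq_mul, hcb]
    linarith [mul_le_mul_of_nonneg_left hfz hs₀]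
  · have hconv := (hg.convexOn w i).2 hw hz (sub_nonneg.2 hs₁) hs₀ (by ring)
    have hviol : (1 - b / R) * g w i w ≤ violation g w :=
      (mul_le_mul_of_nonneg_left (le_violation g w i) (sub_nonneg.2 hs₁)).trans
        (mul_le_of_le_one_left (violation_nonneg g w) (by linarith))
    simp only [smul_eq_mul] at hconv
    rw [hcb]
    linarith [mul_le_mul_of_nonneg_left (hgz i) hs₀]

namespace IsTrustRegionDescent

theorem exists_violation_le (hx : IsTrustRegionDescent 𝒳 f₀ g β x) :
    ∃ C, ∀ t, violation g (x (t + 1)) ≤ C * β t ^ 2 := by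
  obtain ⟨C, hC₀, hC⟩ := hx.exists_model_le
  exact ⟨C, fun t => violation_le (by positivity) (hC t)⟩

theorem tendsto_violation (hx : IsTrustRegionDescent 𝒳 f₀ g β x) (hβ : Tendsto β atTop (𝓝 0)) :
    Tendsto (fun t => violation g (x t)) atTop (𝓝 0) := by
  obtain ⟨C, hC⟩ := hx.exists_violation_le
  rw [← tendsto_add_atTop_iff_nat 1]
  refine squeeze_zero (fun t => violation_nonneg g _) hC ?_
  simpa using (hβ.pow 2).const_mul C

theorem exists_local_descent (hx : IsTrustRegionDescent 𝒳 f₀ g β x) (hg : IsConvexModel 𝒳 f₀ g)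
    (hy : ¬IsCritical 𝒳 f₀ g y) :
    ∃ c > 0, ∃ r > 0, ∀ t, ‖x t - y‖ < r → β t < r → violation g (x t) ≤ c * β t →
      f₀ (x (t + 1)) ≤ f₀ (x t) - c * β t := by
  obtain ⟨z, hz, c, hc, hmargin⟩ := hg.exists_margin hy
  obtain ⟨M, hM⟩ := hx.exists_objective_le (f₀ y + 1)
  set R := ‖z - y‖ + 1
  have hRpos : 0 < R := by positivity
  set δ := c / R
  have hδpos : 0 < δ := by positivity
  have hclose : ∀ᶠ w in 𝓝 y, ‖z - w‖ < R ∧ f₀ w < f₀ y + 1 :=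
    (((continuous_const.sub continuous_id).norm).continuousAt.eventually_lt_const
      (lt_add_one _)).and (f₀.continuous.continuousAt.eventually_lt_const (lt_add_one _))
  have hsmall : ∀ᶠ b in 𝓝 (0 : ℝ), b < R ∧ M * b < δ / 2 :=
    (eventually_lt_nhds hRpos).and
      ((continuous_const_mul M).continuousAt.eventually_lt_const (by simpa using half_pos hδpos))
  obtain ⟨r₁, hr₁, hball⟩ := Metric.eventually_nhds_iff.1 (hmargin.and hclose)
  obtain ⟨r₂, hr₂, hrad⟩ := Metric.eventually_nhds_iff.1 hsmall
  refine ⟨δ / 2, half_pos hδpos, min r₁ r₂, lt_min hr₁ hr₂, fun t ht hβr hv => ?_⟩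
  have hβ := hx.radius_nonneg t
  obtain ⟨⟨hfz, hgz⟩, hzw, hfw⟩ := hball (by rw [dist_eq_norm]; exact ht.trans_le (min_le_left _ _))
  obtain ⟨hbR, hMb⟩ := hrad (y := β t) (by
    rw [Real.dist_0_eq_abs, abs_of_nonneg hβ]; exact hβr.trans_le (min_le_right _ _))
  have hMβ : M * β t ^ 2 ≤ δ / 2 * β t := by
    rw [sq, ← mul_assoc]
    exact mul_le_mul_of_nonneg_right hMb.le hβ
  obtain ⟨p, hp, hpx, hfp, hgp⟩ := hg.exists_step (hx.mem t) hz hRpos hzw.le hβ hbR.le hfz.le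
    fun i => (hgz i).le
  have hδβ : 0 ≤ δ * β t := by positivity
  have hnext := hM t p hp hpx (by linarith) fun i => by linarith [hgp i]
  linarith

/-- If the violation exceeds `c * β t`, then removing it reduces the penalty by more than the
objective can increase; otherwise the objective itself decreases. -/
theorem eventually_merit_le (hx : IsTrustRegionDescent 𝒳 f₀ g β x) (hβ : Tendsto β atTop (𝓝 0))
    {c : ℝ} (hc : 0 < c) :
    ∀ᶠ t in atTop,
      (violation g (x t) ≤ c * β t → f₀ (x (t + 1)) ≤ f₀ (x t) - c * β t) →
        merit f₀ g c (x (t + 1)) ≤ merit f₀ g c (x t) - c / 2 * β t := by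
  obtain ⟨C, hC⟩ := hx.exists_violation_le
  set κ := (‖f₀‖ + c) / c with hκdef
  have hκ : 0 ≤ κ := by positivity
  have hlim : Tendsto (fun t => κ * C * β t) atTop (𝓝 0) := by simpa using hβ.const_mul (κ * C)
  filter_upwards [hlim.eventually_le_const (half_pos hc)] with t ht hdesc
  have hβt := hx.radius_nonneg t
  have hnew : κ * violation g (x (t + 1)) ≤ c / 2 * β t :=
    calc κ * violation g (x (t + 1)) ≤ κ * (C * β t ^ 2) := mul_le_mul_of_nonneg_left (hC t) hκ
      _ = κ * C * β t * β t := by ring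
      _ ≤ c / 2 * β t := mul_le_mul_of_nonneg_right ht hβt
  simp only [merit, ← hκdef]
  rcases le_or_gt (violation g (x t)) (c * β t) with hv | hv
  · linarith [hdesc hv, mul_nonneg hκ (violation_nonneg g (x t))]
  · have hpen : (‖f₀‖ + c) * β t ≤ κ * violation g (x t) :=
      calc (‖f₀‖ + c) * β t = κ * (c * β t) := by rw [hκdef]; field_simp
        _ ≤ κ * violation g (x t) := mul_le_mul_of_nonneg_left hv.le hκ
    linarith [hx.objective_le_add t]

theorem tendsto_merit (hx : IsTrustRegionDescent 𝒳 f₀ g β x) (hβ : Tendsto β atTop (𝓝 0)) (c : ℝ)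
    {s : ℕ → ℕ} (hs : Tendsto s atTop atTop) {w : ℝ}
    (hw : Tendsto (fun k => f₀ (x (s k))) atTop (𝓝 w)) :
    Tendsto (fun k => merit f₀ g c (x (s k))) atTop (𝓝 w) := by
  simpa [merit] using
    hw.add (((hx.tendsto_violation hβ).comp hs).const_mul ((‖f₀‖ + c) / c))

theorem isFeasible_of_tendsto (hx : IsTrustRegionDescent 𝒳 f₀ g β x) (hg : IsConvexModel 𝒳 f₀ g)
    (hβ : Tendsto β atTop (𝓝 0)) {s : ℕ → ℕ} (hs : Tendsto s atTop atTop)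
    (hlim : Tendsto (fun k => x (s k)) atTop (𝓝 y)) (hy : 0 < f₀ y) :
    IsFeasible 𝒳 (g y) y := by
  refine ⟨hg.mem_of_mem_closure y (mem_closure_of_tendsto hlim (.of_forall fun k => hx.mem _)) hy,
    fun i => ?_⟩
  have hcont : Continuous fun z => g z i z :=
    (hg.continuous i).comp (continuous_id.prodMk continuous_id)
  exact le_of_tendsto_of_tendsto' ((hcont.tendsto y).comp hlim) ((hx.tendsto_violation hβ).comp hs)
    fun k => le_violation g (x (s k)) i

theorem exists_isFeasible_of_tendsto_objective [FiniteDimensional ℝ E]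
    (hx : IsTrustRegionDescent 𝒳 f₀ g β x) (hg : IsConvexModel 𝒳 f₀ g)
    (hβ : Tendsto β atTop (𝓝 0)) {s : ℕ → ℕ} (hs : Tendsto s atTop atTop) {w : ℝ} (hw : 0 < w)
    (hlim : Tendsto (fun k => f₀ (x (s k))) atTop (𝓝 w)) :
    ∃ y, IsFeasible 𝒳 (g y) y ∧ f₀ y = w ∧
      ∃ ψ : ℕ → ℕ, StrictMono ψ ∧ Tendsto (fun k => x (s (ψ k))) atTop (𝓝 y) := by
  obtain ⟨R, hR⟩ := hg.exists_norm_le (w + 1)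
  have hbdd : ∀ᶠ k in atTop, x (s k) ∈ Metric.closedBall 0 R := by
    filter_upwards [hlim.eventually_le_const (lt_add_one w),
      ((hx.tendsto_violation hβ).comp hs).eventually_le_const one_pos] with k hfk hvk
    exact mem_closedBall_zero_iff.2
      (hR _ (hx.mem _) (fun i => (le_violation g _ i).trans hvk) hfk)
  obtain ⟨y, -, ψ, hψ, hy⟩ :=
    tendsto_subseq_of_frequently_bounded Metric.isBounded_closedBall hbdd.frequently
  have hfy : f₀ y = w :=
    tendsto_nhds_unique ((f₀.continuous.tendsto y).comp hy) (hlim.comp hψ.tendsto_atTop)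
  exact ⟨y, hx.isFeasible_of_tendsto hg hβ (hs.comp hψ.tendsto_atTop) hy (hfy ▸ hw), hfy, ψ, hψ, hy⟩

theorem exists_level_descent [FiniteDimensional ℝ E] (hx : IsTrustRegionDescent 𝒳 f₀ g β x)
    (hg : IsConvexModel 𝒳 f₀ g) (hβ : Tendsto β atTop (𝓝 0)) {w : ℝ} (hw : 0 < w)
    (hcrit : ∀ y, IsFeasible 𝒳 (g y) y → f₀ y = w → ¬IsCritical 𝒳 f₀ g y) :
    ∃ c > 0, ∀ᶠ t in atTop, |f₀ (x t) - w| < c → violation g (x t) ≤ c * β t →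
      f₀ (x (t + 1)) ≤ f₀ (x t) - c * β t := by
  by_contra! hcon
  have hzero : Tendsto (fun m : ℕ => 1 / ((m : ℝ) + 1)) atTop (𝓝 0) :=
    tendsto_one_div_add_atTop_nhds_zero_nat
  choose s hs hlevel hviol hfail using fun m : ℕ =>
    frequently_atTop.1 (hcon _ (Nat.one_div_pos_of_nat (α := ℝ) (n := m))) m
  have hs_lim : Tendsto s atTop atTop := tendsto_atTop_mono hs tendsto_id
  have hf_lim : Tendsto (fun m => f₀ (x (s m))) atTop (𝓝 w) :=
    tendsto_iff_norm_sub_tendsto_zero.2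
      (squeeze_zero (fun m => norm_nonneg _) (fun m => (hlevel m).le) hzero)
  obtain ⟨y, hfeas, hfy, ψ, hψ, hy⟩ :=
    hx.exists_isFeasible_of_tendsto_objective hg hβ hs_lim hw hf_lim
  obtain ⟨c, hc, r, hr, hdesc⟩ := hx.exists_local_descent hg (hcrit y hfeas hfy)
  have hψ_lim := hψ.tendsto_atTop
  obtain ⟨k, hk_near, hk_rad, hk_small⟩ :=
    (((tendsto_iff_norm_sub_tendsto_zero.1 hy).eventually_lt_const hr).and
      (((hβ.comp (hs_lim.comp hψ_lim)).eventually_lt_const hr).and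
        ((hzero.comp hψ_lim).eventually_le_const hc))).exists
  have hmono := mul_le_mul_of_nonneg_right hk_small (hx.radius_nonneg (s (ψ k)))
  exact (hfail (ψ k)).not_ge
    ((hdesc _ hk_near hk_rad ((hviol _).trans hmono)).trans (sub_le_sub_left hmono _))

theorem eventually_objective_le_of_level [FiniteDimensional ℝ E]
    (hx : IsTrustRegionDescent 𝒳 f₀ g β x) (hg : IsConvexModel 𝒳 f₀ g)
    (hβ : Tendsto β atTop (𝓝 0)) {w w' : ℝ} (hw : 0 < w) (hw' : w' < w)
    (hcrit : ∀ y, IsFeasible 𝒳 (g y) y → f₀ y = w → ¬IsCritical 𝒳 f₀ g y) :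
    ∀ᶠ s in atTop, f₀ (x s) ≤ w' → ∀ t ≥ s, f₀ (x t) ≤ w := by
  obtain ⟨c, hc, hdesc⟩ := hx.exists_level_descent hg hβ hw hcrit
  have hpen : Tendsto (fun t => (‖f₀‖ + c) / c * violation g (x t)) atTop (𝓝 0) := by
    simpa using (hx.tendsto_violation hβ).const_mul ((‖f₀‖ + c) / c)
  have hjump : Tendsto (fun t => ‖f₀‖ * β t + (‖f₀‖ + c) / c * violation g (x (t + 1))) atTop
      (𝓝 0) := by
    simpa using (hβ.const_mul ‖f₀‖).add ((tendsto_add_atTop_iff_nat 1).2 hpen)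
  filter_upwards [eventually_forall_ge_atTop.2 (hdesc.and ((hx.eventually_merit_le hβ hc).and
    ((hjump.eventually_le_const hc).and
      (hpen.eventually_le_const (sub_pos.2 hw')))))] with s hs hsw t ht
  suffices hmerit : merit f₀ g c (x t) ≤ w from (le_merit hc.le _).trans hmerit
  induction t, ht using Nat.le_induction with
  | base =>
    rw [merit]
    linarith [(hs s le_rfl).2.2.2]
  | succ t ht ih =>
    obtain ⟨hdesc_t, hmerit_t, hjump_t, -⟩ := hs t ht
    rcases lt_or_ge (|f₀ (x t) - w|) c with hnear | hfar
    · have hβt := hx.radius_nonneg t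
      have hdecr : 0 ≤ c / 2 * β t := by positivity
      linarith [hmerit_t (hdesc_t hnear)]
    · have hbelow : f₀ (x t) ≤ w - c := by
        rcases le_abs.1 hfar with h | h <;> linarith [le_merit (f₀ := f₀) (g := g) hc.le (x t)]
      rw [merit]
      linarith [hx.objective_le_add t]

theorem isCritical_of_tendsto [FiniteDimensional ℝ E] (hx : IsTrustRegionDescent 𝒳 f₀ g β x)
    (hg : IsConvexModel 𝒳 f₀ g) (hβ : Tendsto β atTop (𝓝 0))
    (hβ_sum : Tendsto (fun m => ∑ t ∈ Finset.range m, β t) atTop atTop)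
    (hnull : MeasureTheory.volume
      (f₀ '' {z | IsFeasible 𝒳 (g z) z ∧ IsCritical 𝒳 f₀ g z}) = 0)
    {φ : ℕ → ℕ} (hφ : Tendsto φ atTop atTop) (hlim : Tendsto (fun k => x (φ k)) atTop (𝓝 y))
    (hy : 0 < f₀ y) : IsCritical 𝒳 f₀ g y := by
  by_contra hncrit
  obtain ⟨c, hc, r, hr, hdesc⟩ := hx.exists_local_descent hg hncrit
  have hf_lim : Tendsto (fun k => f₀ (x (φ k))) atTop (𝓝 (f₀ y)) :=
    (f₀.continuous.tendsto y).comp hlim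
  set δ := c / 2 * (r / 2) with hδdef
  have hδ : 0 < δ := by positivity
  obtain ⟨w, ⟨hw', hwy⟩, hw_mem⟩ : ∃ w ∈ Set.Ioo (max 0 (f₀ y - δ / 2)) (f₀ y),
      w ∉ f₀ '' {z | IsFeasible 𝒳 (g z) z ∧ IsCritical 𝒳 f₀ g z} := by
    by_contra! hcon
    have hvol := MeasureTheory.measure_mono_null hcon hnull
    rw [Real.volume_Ioo, ENNReal.ofReal_eq_zero, sub_nonpos, le_max_iff] at hvol
    rcases hvol with h | h <;> linarith
  have hbarrier := hx.eventually_objective_le_of_level hg hβ ((le_max_left _ _).trans_lt hw')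
    ((le_max_right _ _).trans_lt hw') fun z hz hzw hzc => hw_mem ⟨z, ⟨hz, hzc⟩, hzw⟩
  obtain ⟨k, hk_near, hk_merit, hk⟩ :=
    (((tendsto_iff_norm_sub_tendsto_zero.1 hlim).eventually_lt_const (half_pos hr)).and
      (((hx.tendsto_merit hβ c hφ hf_lim).eventually_lt_const
        (lt_add_of_pos_right (f₀ y) (half_pos hδ))).and
      (hφ.eventually (eventually_forall_ge_atTop.2 ((hx.eventually_merit_le hβ hc).and
        ((hβ.eventually_lt_const hr).and hbarrier)))))).exists
  obtain ⟨t, ht, hmerit⟩ := exists_le_sub_of_decrease (half_pos hc) hβ_sum hx.norm_sub_le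
    (fun t => (hg.pos _ (hx.mem t)).le.trans (le_merit hc.le _)) hk_near
    fun t ht hball => (hk t ht).1 (hdesc t hball (hk t ht).2.1)
  have hlow : f₀ (x t) ≤ f₀ y - δ / 2 := by
    linarith [le_merit (f₀ := f₀) (g := g) hc.le (x t)]
  obtain ⟨m, hm_obj, hm⟩ := ((hf_lim.eventually_const_lt hwy).and
    (hφ.eventually_ge_atTop t)).exists
  exact hm_obj.not_ge ((hk t ht).2.2 hlow _ hm)

end IsTrustRegionDescent

end Model

/-! ### The functions `y` -/

section YFun

open scoped ContDiff

variable {ι : Type*} {D : Scenario ι}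

theorem Scenario.crlbτ_nonneg (D : Scenario ι) (n : ι) : 0 ≤ D.crlbτ n := by
  have := D.E_pos
  have := D.σ2_pos n
  unfold Scenario.crlbτ
  positivity

theorem Scenario.crlbα_nonneg (D : Scenario ι) (n : ι) : 0 ≤ D.crlbα n := by
  have := D.E_pos
  have := D.σ2_pos n
  unfold Scenario.crlbα
  positivity

theorem Scenario.posDef_Qr (D : Scenario ι) (n : ι) : (D.Qr n).PosDef := by
  have hE := D.E_pos
  have hσ := D.σ2_pos n
  have hτ := D.crlbτ_nonneg n
  have hα := D.crlbα_nonneg n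
  have hrank1 : ∀ p : D.Idx n → ℝ, (Matrix.vecMulVec p p).PosSemidef := fun p => by
    simpa using Matrix.posSemidef_vecMulVec_self_star p
  unfold Scenario.Qr
  refine Matrix.PosDef.posSemidef_add
    (((hrank1 _).smul ?_).add ((hrank1 _).smul ?_) |>.add ((hrank1 _).smul ?_))
    (Matrix.PosDef.one.smul ?_)
  all_goals positivity

theorem KLT.transpose_mul_self (T : KLT D) (n : ι) : (T.U n)ᵀ * T.U n = 1 := by
  simpa [Matrix.star_eq_conjTranspose] using
    (Matrix.mem_orthogonalGroup_iff' _ _).1 (T.orthogonal n)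

theorem KLT.γ_pos (T : KLT D) (n : ι) (j : D.Idx n) : 0 < T.γ n j := by
  have hdiag : (T.U n)ᵀ * D.Qr n * T.U n = Matrix.diagonal (T.γ n) := by
    rw [T.decomp n, ← mul_assoc, ← mul_assoc, T.transpose_mul_self, one_mul, mul_assoc,
      T.transpose_mul_self, mul_one]
  have hpos := (Matrix.IsUnit.posDef_star_left_conjugate_iff
    (IsUnit.of_mul_eq_one_right _ (T.transpose_mul_self n))).2 (D.posDef_Qr n)
  rw [Matrix.star_eq_conjTranspose, Matrix.conjTranspose_eq_transpose_of_trivial, hdiag,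
    Matrix.posDef_diagonal_iff] at hpos
  exact hpos j

theorem hasDerivAt_sigmoid_affine (b c X : ℝ) :
    HasDerivAt (fun X => Real.sigmoid (b * X - c))
      (b * (Real.sigmoid (b * X - c) * (1 - Real.sigmoid (b * X - c)))) X := by
  have haffine : HasDerivAt (fun X : ℝ => b * X - c) b X := by
    simpa using ((hasDerivAt_id X).const_mul b).sub_const c
  exact ((Real.hasDerivAt_sigmoid (b * X - c)).comp X haffine).congr_deriv (mul_comm _ _)

variable (T : KLT D) (n : D.Ω) (j : D.Idx n)

theorem yfun_eq_sigmoid (X : ℝ) :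
    yfun T n j X = 2 / D.σ2 n *
      Real.sigmoid (2 * Real.log 2 * X - Real.log (4 * T.γ n j / D.σ2 n)) := by
  have hσ := D.σ2_pos n
  have hγ := T.γ_pos n j
  have : (0 : ℝ) < 2 ^ (2 * X) := by positivity
  have hpow₁ : (2 : ℝ) ^ (2 * X - 1) = 2 ^ (2 * X) / 2 := by
    rw [Real.rpow_sub two_pos, Real.rpow_one]
  have hpow₂ : (2 : ℝ) ^ (2 * X - 2) = 2 ^ (2 * X) / 4 := by
    rw [Real.rpow_sub two_pos, Real.rpow_two]
    norm_num
  have hexp : Real.exp (-(2 * Real.log 2 * X - Real.log (4 * T.γ n j / D.σ2 n)))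
      = (4 * T.γ n j / D.σ2 n) / 2 ^ (2 * X) := by
    rw [neg_sub, Real.exp_sub, Real.exp_log (by positivity), Real.rpow_def_of_pos two_pos,
      mul_assoc, mul_left_comm]
  rw [yfun, Real.sigmoid_def, hpow₁, hpow₂, hexp]
  field_simp
  ring

theorem yfun_pos (X : ℝ) : 0 < yfun T n j X := by
  have hσ := D.σ2_pos n
  have hγ := T.γ_pos n j
  unfold yfun
  positivity

theorem inv_add_div_eq_yfun (X : ℝ) :
    (1 / 2 * D.σ2 n + T.γ n j / (2 : ℝ) ^ (2 * X - 1))⁻¹ = yfun T n j X := by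
  have hσ := D.σ2_pos n
  have hγ := T.γ_pos n j
  have : (0 : ℝ) < 2 ^ (2 * X - 1) := by positivity
  have hpow₂ : (2 : ℝ) ^ (2 * X - 2) = 2 ^ (2 * X - 1) / 2 := by
    rw [← Real.rpow_sub_one two_ne_zero, sub_sub, one_add_one_eq_two]
  rw [yfun, hpow₂]
  field_simp
  ring

/-- The derivative of `y_n`. -/
noncomputable def ySlope (X : ℝ) : ℝ :=
  let p := Real.sigmoid (2 * Real.log 2 * X - Real.log (4 * T.γ n j / D.σ2 n))
  2 / D.σ2 n * (2 * Real.log 2) * (p * (1 - p))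

theorem hasDerivAt_yfun (X : ℝ) : HasDerivAt (yfun T n j) (ySlope T n j X) X := by
  rw [funext (yfun_eq_sigmoid T n j)]
  refine ((hasDerivAt_sigmoid_affine _ _ X).const_mul _).congr_deriv ?_
  simp only [ySlope]
  ring

theorem tangent_eq (Xt X : ℝ) :
    tangent T n j Xt X = yfun T n j Xt + ySlope T n j Xt * (X - Xt) := by
  rw [tangent, (hasDerivAt_yfun T n j Xt).deriv]
  ring

theorem ySlope_pos (X : ℝ) : 0 < ySlope T n j X := by
  have hσ := D.σ2_pos n
  have := Real.log_pos one_lt_two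
  have hpos := Real.sigmoid_pos (2 * Real.log 2 * X - Real.log (4 * T.γ n j / D.σ2 n))
  have hlt := sub_pos.2
    (Real.sigmoid_lt_one (2 * Real.log 2 * X - Real.log (4 * T.γ n j / D.σ2 n)))
  simp only [ySlope]
  positivity

theorem contDiff_yfun : ContDiff ℝ ω (yfun T n j) := by
  rw [funext (yfun_eq_sigmoid T n j)]
  exact contDiff_const.mul (contDiff_sigmoid.comp (by fun_prop))

theorem continuous_ySlope : Continuous (ySlope T n j) := by
  have := differentiable_sigmoid.continuous
  unfold ySlope
  fun_prop

theorem abs_mul_one_sub_mul_le_one {p : ℝ} (h₀ : 0 < p) (h₁ : p < 1) :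
    |p * (1 - p) * (1 - 2 * p)| ≤ 1 := by
  rw [abs_mul]
  refine mul_le_one₀ ?_ (abs_nonneg _) ?_ <;> rw [abs_le] <;> constructor <;> nlinarith

variable (D) in
/-- A Lipschitz constant of the derivatives of the functions `y_n`. -/
noncomputable def curvature : ℝ := 2 / D.σ2 n * (2 * Real.log 2) * (2 * Real.log 2)

variable (D) in
theorem curvature_nonneg : 0 ≤ curvature D n := by
  have := D.σ2_pos n
  have := Real.log_pos one_lt_two
  unfold curvature
  positivity

theorem abs_ySlope_sub_le (X X' : ℝ) :
    |ySlope T n j X' - ySlope T n j X| ≤ curvature D n * |X' - X| := by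
  let b := 2 * Real.log 2
  let p : ℝ → ℝ := fun Y => Real.sigmoid (b * Y - Real.log (4 * T.γ n j / D.σ2 n))
  have hderiv : ∀ Y ∈ Set.univ, HasDerivWithinAt (ySlope T n j)
      (curvature D n * (p Y * (1 - p Y) * (1 - 2 * p Y))) Set.univ Y := fun Y _ => by
    have hp := hasDerivAt_sigmoid_affine b (Real.log (4 * T.γ n j / D.σ2 n)) Y
    refine (((hp.mul (hp.const_sub 1)).const_mul (2 / D.σ2 n * b)).congr_deriv
      ?_).hasDerivWithinAt
    simp only [curvature, p, b]
    ring
  refine convex_univ.norm_image_sub_le_of_norm_hasDerivWithin_le hderiv (fun Y _ => ?_)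
    (Set.mem_univ X) (Set.mem_univ X')
  rw [Real.norm_eq_abs, abs_mul, abs_of_nonneg (curvature_nonneg D n)]
  exact mul_le_of_le_one_right (curvature_nonneg D n)
    (abs_mul_one_sub_mul_le_one (Real.sigmoid_pos _) (Real.sigmoid_lt_one _))

theorem abs_yfun_sub_tangent_le (Xt X : ℝ) :
    |yfun T n j X - tangent T n j Xt X| ≤ curvature D n * |X - Xt| ^ 2 := by
  have hbound := (convex_uIcc Xt X).norm_image_sub_le_of_norm_hasDerivWithin_le
    (f := fun Y => yfun T n j Y - ySlope T n j Xt * Y)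
    (f' := fun Y => ySlope T n j Y - ySlope T n j Xt) (C := curvature D n * |X - Xt|)
    (fun Y _ => ((hasDerivAt_yfun T n j Y).sub
      (by simpa using (hasDerivAt_id Y).const_mul (ySlope T n j Xt))).hasDerivWithinAt)
    (fun Y hY => (abs_ySlope_sub_le T n j Xt Y).trans (mul_le_mul_of_nonneg_left
      (Set.abs_sub_left_of_mem_uIcc hY) (curvature_nonneg D n)))
    Set.left_mem_uIcc Set.right_mem_uIcc
  rw [Real.norm_eq_abs, Real.norm_eq_abs, mul_assoc, ← pow_two] at hbound
  rw [tangent_eq]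
  convert hbound using 2
  ring

end YFun

/-! ### The Fisher information matrix and its tangent -/

section Fisher

open scoped Matrix.Norms.L2Operator ContDiff

variable {ι : Type*} {D : Scenario ι} (T : KLT D)

theorem inv_conj_diagonal {n : Type*} [Fintype n] [DecidableEq n] {U : Matrix n n ℝ}
    (hU : Uᵀ * U = 1) {d : n → ℝ} (hd : ∀ j, d j ≠ 0) :
    (U * Matrix.diagonal d * Uᵀ)⁻¹ = U * Matrix.diagonal (fun j => (d j)⁻¹) * Uᵀ := by
  refine Matrix.inv_eq_right_inv ?_
  calc U * Matrix.diagonal d * Uᵀ * (U * Matrix.diagonal (fun j => (d j)⁻¹) * Uᵀ)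
      = U * (Matrix.diagonal d * (Uᵀ * U) * Matrix.diagonal fun j => (d j)⁻¹) * Uᵀ := by
        simp only [Matrix.mul_assoc]
    _ = 1 := by simp [hU, hd, mul_eq_one_comm.1 hU]

/-- `∑ₙ (∂sₙ Uₙ) diag(y_n) (∂sₙ Uₙ)ᵀ` as a linear function of the weights `y`. -/
noncomputable def info : ((n : D.Ω) → D.Idx n → ℝ) →L[ℝ] Matrix (Fin 2) (Fin 2) ℝ :=
  LinearMap.toContinuousLinearMap
    { toFun := fun y =>
        ∑ n : D.Ω, (D.jac n * T.U n) * Matrix.diagonal (y n) * (D.jac n * T.U n)ᵀ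
      map_add' := fun y y' => by
        rw [← Finset.sum_add_distrib]
        refine Finset.sum_congr rfl fun n _ => ?_
        rw [← Matrix.add_mul, ← Matrix.mul_add, Matrix.diagonal_add]
        rfl
      map_smul' := fun c y => by
        simp [Matrix.diagonal_smul, Finset.smul_sum] }

theorem info_apply (y : (n : D.Ω) → D.Idx n → ℝ) : info T y =
    ∑ n : D.Ω, (D.jac n * T.U n) * Matrix.diagonal (y n) * (D.jac n * T.U n)ᵀ := rfl

theorem isSymm_info (y : (n : D.Ω) → D.Idx n → ℝ) : (info T y).IsSymm := by
  simp [Matrix.IsSymm, info_apply, Matrix.transpose_sum, Matrix.mul_assoc]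

theorem fisher_eq_info (x : Var D) :
    fisher T x = info T fun n j => yfun T n j (bits x n j) := by
  rw [fisher, info_apply]
  refine Finset.sum_congr rfl fun n _ => ?_
  have hU := T.transpose_mul_self n
  have hcov : (1 / 2 * D.σ2 n) • (1 : Matrix (D.Idx n) (D.Idx n) ℝ) + quantCov T x n
      = T.U n * Matrix.diagonal (fun j => 1 / 2 * D.σ2 n +
        T.γ n j / (2 : ℝ) ^ (2 * bits x n j - 1)) * (T.U n)ᵀ := by
    rw [quantCov, ← Matrix.diagonal_add, mul_add, add_mul, ← Matrix.smul_one_eq_diagonal,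
      Matrix.mul_smul, Matrix.smul_mul, mul_one, mul_eq_one_comm.1 hU]
  rw [hcov, inv_conj_diagonal hU fun j h => (yfun_pos T n j (bits x n j)).ne' <| by
    rw [← inv_add_div_eq_yfun, h, inv_zero]]
  simp only [inv_add_div_eq_yfun, Matrix.transpose_mul, Matrix.mul_assoc]

theorem fisherSurr_eq_info (x z : Var D) :
    fisherSurr T x z = info T fun n j => tangent T n j (bits x n j) (bits z n j) :=
  (info_apply T _).symm

/-- The derivative of the Fisher information matrix at the point `x`. -/
noncomputable def fisherDeriv (x : Var D) : Var D →L[ℝ] Matrix (Fin 2) (Fin 2) ℝ :=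
  (info T).comp <| ContinuousLinearMap.pi fun n => ContinuousLinearMap.pi fun j =>
    ySlope T n j (bits x n j) • EuclideanSpace.proj (Sum.inl ⟨n, j⟩)

theorem fisherDeriv_apply (x d : Var D) :
    fisherDeriv T x d = info T fun n j => ySlope T n j (bits x n j) * bits d n j := rfl

theorem hasFDerivAt_bits (n : D.Ω) (j : D.Idx n) (x : Var D) :
    HasFDerivAt (fun x => bits x n j)
      (EuclideanSpace.proj (Sum.inl ⟨n, j⟩) : Var D →L[ℝ] ℝ) x :=
  (EuclideanSpace.proj (Sum.inl ⟨n, j⟩) : Var D →L[ℝ] ℝ).hasFDerivAt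

theorem hasFDerivAt_fisher (x : Var D) : HasFDerivAt (fisher T) (fisherDeriv T x) x := by
  rw [funext (fisher_eq_info T)]
  exact (info T).hasFDerivAt.comp x <| hasFDerivAt_pi.2 fun n => hasFDerivAt_pi.2 fun j =>
    (hasDerivAt_yfun T n j _).comp_hasFDerivAt x (hasFDerivAt_bits n j x)

theorem contDiff_fisher : ContDiff ℝ ω (fisher T) := by
  rw [funext (fisher_eq_info T)]
  exact (info T).contDiff.comp <| contDiff_pi.2 fun n => contDiff_pi.2 fun j =>
    (contDiff_yfun T n j).comp
      (EuclideanSpace.proj (Sum.inl ⟨n, j⟩) : Var D →L[ℝ] ℝ).contDiff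

theorem fisherSurr_eq_add (x z : Var D) :
    fisherSurr T x z = fisher T x + fisherDeriv T x (z - x) := by
  rw [fisherSurr_eq_info, fisher_eq_info, fisherDeriv_apply, ← map_add]
  simp only [tangent_eq]
  rfl

theorem fisherSurr_self (x : Var D) : fisherSurr T x x = fisher T x := by
  simp [fisherSurr_eq_add]

theorem hasFDerivAt_fisherSurr (x z : Var D) :
    HasFDerivAt (fisherSurr T x) (fisherDeriv T x) z := by
  rw [funext (fisherSurr_eq_add T x)]
  exact ((fisherDeriv T x).hasFDerivAt.comp z ((hasFDerivAt_id z).sub_const x)).const_add _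

theorem isSymm_fisherSurr (x z : Var D) : (fisherSurr T x z).IsSymm :=
  fisherSurr_eq_info T x z ▸ isSymm_info T _

theorem continuous_fisherSurr : Continuous fun p : Var D × Var D => fisherSurr T p.1 p.2 := by
  simp only [fisherSurr_eq_info, tangent_eq]
  refine (info T).continuous.comp (continuous_pi fun n => continuous_pi fun j => ?_)
  have := (contDiff_yfun T n j).continuous
  have := continuous_ySlope T n j
  unfold bits
  fun_prop

theorem exists_norm_fisher_sub_le :
    ∃ C, 0 ≤ C ∧ ∀ x z : Var D, ‖fisher T z - fisherSurr T x z‖ ≤ C * ‖z - x‖ ^ 2 := by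
  let L : ℝ := ∑ n, curvature D n
  have hL : 0 ≤ L := Finset.sum_nonneg fun n _ => curvature_nonneg D n
  refine ⟨‖info T‖ * L, by positivity, fun x z => ?_⟩
  rw [fisher_eq_info, fisherSurr_eq_info, ← map_sub, mul_assoc]
  refine (info T).le_opNorm_of_le ?_
  have hnonneg : 0 ≤ L * ‖z - x‖ ^ 2 := by positivity
  refine (pi_norm_le_iff_of_nonneg hnonneg).2 fun n => (pi_norm_le_iff_of_nonneg hnonneg).2
    fun j => (abs_yfun_sub_tangent_le T n j _ _).trans ?_
  gcongr
  · exact Finset.single_le_sum (fun n _ => curvature_nonneg D n) (Finset.mem_univ n)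
  · exact PiLp.norm_apply_le (z - x) (Sum.inl ⟨n, j⟩)

end Fisher

/-! ### Convex models of the constraints -/

section ConvexModel

open scoped Matrix.Norms.L2Operator

variable {ι : Type*} {D : Scenario ι} (T : KLT D)

/-- The number of channel uses as a continuous linear functional. -/
noncomputable def usesCLM : Var D →L[ℝ] ℝ := EuclideanSpace.proj (Sum.inr (Sum.inl ()))

/-- The linear parts of the trace constraint and of the capacity constraints in linear form. -/
noncomputable def linCon : Unit ⊕ {S : Finset D.Ω // S.Nonempty} → Var D →L[ℝ] ℝ
  | .inl _ => ∑ i, EuclideanSpace.proj (Sum.inr (Sum.inr (i, i)))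
  | .inr S => ∑ n ∈ S.1, ∑ j, EuclideanSpace.proj (Sum.inl ⟨n, j⟩) - capacity D S.1 • usesCLM

theorem linCon_inl_apply (z : Var D) : linCon (.inl ()) z = (aux z).trace := by
  simp [linCon, aux, Matrix.trace]

theorem linCon_inr_apply (S : {S : Finset D.Ω // S.Nonempty}) (z : Var D) :
    linCon (.inr S) z = capacityFun .linear S.1 z := by
  simp [linCon, capacityFun, usesCLM, uses, bits, mul_comm]

variable (D) in
/-- The right-hand sides of the constraints with linear parts `linCon`. -/
def linBound : Unit ⊕ {S : Finset D.Ω // S.Nonempty} → ℝ := Sum.elim (fun _ => D.ε) 0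

theorem con_linear_inr (k : Unit ⊕ {S : Finset D.Ω // S.Nonempty}) (z : Var D) :
    con T .linear (.inr k) z = linCon k z - linBound D k := by
  match k with
  | .inl _ => rw [linCon_inl_apply]; rfl
  | .inr S => rw [linCon_inr_apply]; exact (sub_zero _).symm

/-- The convex constraint functions at the point `x`: the Fisher information matrix is replaced by
its tangent at `x` and the capacity constraints are taken in linear form. -/
noncomputable def conModel (x : Var D) : Con D → Var D → ℝ
  | .inl _, z => -minEig (blockMat (aux z) (fisherSurr T x z))
  | .inr k, z => con T .linear (.inr k) z

theorem conModel_self_inl (x : Var D) :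
    conModel T x (.inl ()) x = -minEig (blockMat (aux x) (fisher T x)) := by
  rw [conModel, fisherSurr_self]

theorem convex_domain : Convex ℝ (domain D) := by
  rintro x ⟨hx₁, hx₂, hx₃⟩ z ⟨hz₁, hz₂, hz₃⟩ a b ha hb hab
  refine ⟨fun n j => ?_, convex_Ioi (0 : ℝ) hx₂ hz₂ ha hb hab, ?_⟩
  · exact convex_Ici (0 : ℝ) (hx₁ n j) (hz₁ n j) ha hb hab
  · exact (hx₃.smul a).add (hz₃.smul b)

theorem fisherSurr_combo (x z w : Var D) {a b : ℝ} (hab : a + b = 1) :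
    fisherSurr T x (a • z + b • w) = a • fisherSurr T x z + b • fisherSurr T x w := by
  obtain rfl := eq_sub_of_add_eq' hab
  simp only [fisherSurr_eq_add, map_sub, map_add, map_smul]
  module

theorem convexOn_conModel (x : Var D) (i : Con D) : ConvexOn ℝ Set.univ (conModel T x i) := by
  match i with
  | .inl _ =>
    refine neg_convexOn_iff.2 ⟨convex_univ, fun z _ w _ a b ha hb hab => ?_⟩
    have hcombo : blockMat (aux (a • z + b • w)) (fisherSurr T x (a • z + b • w)) =
        a • blockMat (aux z) (fisherSurr T x z) + b • blockMat (aux w) (fisherSurr T x w) := by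
      simp only [blockMat, Matrix.fromBlocks_smul, Matrix.fromBlocks_add, ← add_smul, hab, one_smul,
        fisherSurr_combo T x z w hab]
      rfl
    simpa only [hcombo] using concaveOn_minEig.2 (Set.mem_univ _) (Set.mem_univ _) ha hb hab
  | .inr k =>
    have hlin : conModel T x (.inr k) = fun z => linCon k z - linBound D k :=
      funext (con_linear_inr T k)
    rw [hlin]
    exact ((linCon k).toLinearMap.convexOn convex_univ).sub (concaveOn_const _ convex_univ)

theorem continuous_aux : Continuous (aux : Var D → Matrix (Fin 2) (Fin 2) ℝ) := by
  refine continuous_matrix fun i k => ?_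
  simp only [aux, Matrix.of_apply]
  fun_prop

theorem continuous_conModel (i : Con D) :
    Continuous fun p : Var D × Var D => conModel T p.1 i p.2 := by
  match i with
  | .inl _ =>
    exact (continuous_minEig.comp <| (continuous_aux.comp continuous_snd).matrix_fromBlocks
      continuous_const continuous_const (continuous_fisherSurr T)).neg
  | .inr k =>
    simp only [conModel, con_linear_inr]
    fun_prop

theorem exists_abs_conModel_sub_le : ∃ C, 0 ≤ C ∧ ∀ (x z : Var D) (i : Con D),
    |conModel T z i z - conModel T x i z| ≤ C * ‖z - x‖ ^ 2 := by
  obtain ⟨C, hC, hle⟩ := exists_norm_fisher_sub_le T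
  refine ⟨C, hC, fun x z i => ?_⟩
  match i with
  | .inl _ =>
    rw [conModel_self_inl, conModel, neg_sub_neg, abs_sub_comm]
    exact (abs_minEig_fromBlocks_sub_le _ _ _ _ _).trans (hle x z)
  | .inr k =>
    rw [conModel, conModel, sub_self, abs_zero]
    positivity

theorem capacity_pos {S : Finset D.Ω} (hS : S.Nonempty) : 0 < capacity D S := by
  refine Real.logb_pos one_lt_two (lt_add_of_pos_right _ (div_pos ?_ D.N₀_pos))
  exact Finset.sum_pos (fun n _ => mul_pos (D.P_pos n) (D.g_pos n)) hS

theorem bits_le_of_capacityFun_le {x : Var D} (hx : x ∈ domain D) {n : D.Ω}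
    (hcap : capacityFun .linear {n} x ≤ 1) (j : D.Idx n) :
    bits x n j ≤ uses x * capacity D {n} + 1 := by
  simp only [capacityFun, Finset.sum_singleton] at hcap
  linarith [Finset.single_le_sum (f := bits x n) (fun j _ => hx.1 n j) (Finset.mem_univ j)]

theorem abs_aux_le {x : Var D} (hx : x ∈ domain D)
    (hG : -1 ≤ minEig (blockMat (aux x) (fisher T x))) (htr : (aux x).trace ≤ D.ε + 1)
    (i k : Fin 2) : |aux x i k| ≤ |D.ε| + 4 := by
  have hsymm : (blockMat (aux x) (fisher T x) + (1 : ℝ) • 1).IsSymm := by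
    refine Matrix.IsSymm.add (hx.2.2.fromBlocks Matrix.transpose_one ?_)
      (Matrix.isSymm_one.smul 1)
    exact fisherSurr_self T x ▸ isSymm_fisherSurr T x x
  have hpsd := ((minEig_nonneg_iff_posSemidef hsymm).1
    (minEig_add_smul_one_nonneg hG)).submatrix (Sum.inl : Fin 2 → Fin 2 ⊕ Fin 2)
  have hsub : (blockMat (aux x) (fisher T x) + (1 : ℝ) • 1).submatrix Sum.inl Sum.inl =
      aux x + 1 := by
    rw [one_smul, ← Matrix.fromBlocks_one, blockMat, Matrix.fromBlocks_add]
    rfl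
  rw [hsub] at hpsd
  have happly := abs_apply_le_trace_of_posSemidef hpsd i k
  rw [Matrix.trace_add, Matrix.trace_one, Fintype.card_fin, Matrix.add_apply] at happly
  have hone : |(1 : Matrix (Fin 2) (Fin 2) ℝ) i k| ≤ 1 := by
    rw [Matrix.one_apply]
    split_ifs <;> simp
  have := abs_sub_abs_le_abs_add (aux x i k) ((1 : Matrix (Fin 2) (Fin 2) ℝ) i k)
  push_cast at happly
  linarith [le_abs_self D.ε]

theorem exists_norm_le_of_conModel_le (B : ℝ) : ∃ R, ∀ x ∈ domain D,
    (∀ i, conModel T x i x ≤ 1) → uses x ≤ B → ‖x‖ ≤ R := by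
  let R : Coord D → ℝ := Sum.elim (fun p => |B| * capacity D {p.1} + 1)
    (Sum.elim (fun _ => |B|) fun _ => |D.ε| + 4)
  refine ⟨_, fun x hx hcon huses => (EuclideanSpace.norm_eq x).trans_le <| Real.sqrt_le_sqrt <|
    Finset.sum_le_sum fun c _ => pow_le_pow_left₀ (norm_nonneg (x c)) (?_ : ‖x c‖ ≤ R c) 2⟩
  have huses' : uses x ≤ |B| := huses.trans (le_abs_self B)
  match c with
  | .inl ⟨n, j⟩ =>
    refine (abs_of_nonneg (hx.1 n j)).trans_le <| (bits_le_of_capacityFun_le hx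
      (hcon (.inr (.inr ⟨{n}, Finset.singleton_nonempty n⟩))) j).trans ?_
    have := capacity_pos (Finset.singleton_nonempty n)
    simp only [R, Sum.elim_inl]
    gcongr
  | .inr (.inl _) => exact (abs_of_pos hx.2.1).trans_le huses'
  | .inr (.inr (i, k)) =>
    have hG := hcon (.inl ())
    rw [conModel_self_inl, neg_le] at hG
    exact abs_aux_le T hx hG (sub_le_iff_le_add'.1 (hcon (.inr (.inl ())))) i k

theorem mem_domain_of_mem_closure {z : Var D} (hz : z ∈ closure (domain D)) (hpos : 0 < uses z) :
    z ∈ domain D := by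
  have hbits : ∀ n j, 0 ≤ bits z n j := fun n j => closure_minimal (fun z hz => hz.1 n j)
    (isClosed_Ici.preimage (EuclideanSpace.proj (Sum.inl ⟨n, j⟩) : Var D →L[ℝ] ℝ).continuous) hz
  have hsymm : (aux z).IsSymm := closure_minimal (fun z hz => hz.2.2)
    (isClosed_eq continuous_aux.matrix_transpose continuous_aux) hz
  exact ⟨hbits, hpos, hsymm⟩

theorem isConvexModel_conModel : IsConvexModel (domain D) usesCLM (conModel T) where
  convex := convex_domain
  convexOn x i := (convexOn_conModel T x i).subset (Set.subset_univ _) convex_domain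
  continuous := continuous_conModel T
  pos _ hz := hz.2.1
  mem_of_mem_closure _ := mem_domain_of_mem_closure
  exists_norm_le := exists_norm_le_of_conModel_le T

/-- The positive factor that turns a constraint of the relaxed problem into its linear form. -/
def conScale : CapacityForm → Con D → Var D → ℝ
  | .ratio, .inr (.inr _), x => uses x
  | _, _, _ => 1

theorem conScale_pos (F : CapacityForm) (i : Con D) {x : Var D} (hx : 0 < uses x) :
    0 < conScale F i x := by
  unfold conScale
  split
  exacts [hx, one_pos]

theorem conScale_le (F : CapacityForm) (i : Con D) {x : Var D} (hx : 0 < uses x) :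
    conScale F i x ≤ 1 + uses x := by
  unfold conScale
  split <;> linarith

theorem conScale_mul_conSurr (F : CapacityForm) (μ : ℝ) (x : Var D) (i : Con D) {z : Var D}
    (hz : 0 < uses z) : conScale F i z * conSurr T F μ x i z =
      conModel T x i z + conScale F i z * (μ * ‖z - x‖ ^ 2) := by
  match F, i with
  | .ratio, .inr (.inr S) =>
    simp only [conScale, conSurr, con, conModel, capacityFun, ← Finset.sum_div]
    field_simp
  | .linear, .inr (.inr S) | .ratio, .inl _ | .linear, .inl _ | .ratio, .inr (.inl _)
  | .linear, .inr (.inl _) => simp [conScale, conSurr, con, conModel]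

theorem conScale_mul_con (F : CapacityForm) (i : Con D) {x : Var D} (hx : 0 < uses x) :
    conScale F i x * con T F i x = conModel T x i x := by
  have hself : conSurr T F 0 x i x = con T F i x := by
    cases i <;> simp [conSurr, con, fisherSurr_self]
  simpa [hself] using conScale_mul_conSurr T F 0 x i hx

end ConvexModel

/-! ### Critical values -/

section Reduced

open scoped Matrix.Norms.L2Operator ContDiff

variable {ι : Type*} {D : Scenario ι}

variable (D) in
/-- Index set of the constraints of the problem without the auxiliary matrix. -/
abbrev ReducedCon : Type _ := Unit ⊕ {S : Finset D.Ω // S.Nonempty} ⊕ ((n : D.Ω) × D.Idx n)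

/-- The constraints `tr J⁻¹ ≤ ε`, `X(S) ≤ W C_S` and `X_{nj} ≥ 0` that remain after the auxiliary
matrix has been eliminated, for an arbitrary information matrix `J`. -/
noncomputable def reducedCon (J : Var D → Matrix (Fin 2) (Fin 2) ℝ) :
    ReducedCon D → Var D → ℝ
  | .inl _, z => (J z)⁻¹.trace - D.ε
  | .inr (.inl S), z => linCon (.inr S) z
  | .inr (.inr p), z => -bits z p.1 p.2

/-- The derivatives of the functions `reducedCon J` at a point where `J` has the value `A` and the
derivative `J'`. -/
noncomputable def reducedDeriv (A : Matrix (Fin 2) (Fin 2) ℝ)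
    (J' : Var D →L[ℝ] Matrix (Fin 2) (Fin 2) ℝ) :
    ReducedCon D → Var D →L[ℝ] ℝ
  | .inl _ => (LinearMap.toContinuousLinearMap (Matrix.traceLinearMap (Fin 2) ℝ ℝ)).comp
      ((-ContinuousLinearMap.mulLeftRight ℝ (Matrix (Fin 2) (Fin 2) ℝ) A⁻¹ A⁻¹).comp J')
  | .inr (.inl S) => linCon (.inr S)
  | .inr (.inr p) => -EuclideanSpace.proj (Sum.inl p)

theorem reducedCon_congr {J J' : Var D → Matrix (Fin 2) (Fin 2) ℝ} {x : Var D} (h : J x = J' x)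
    (k : ReducedCon D) : reducedCon J k x = reducedCon J' k x := by
  match k with
  | .inl _ | .inr (.inl _) | .inr (.inr _) => simp only [reducedCon, h]

theorem hasFDerivAt_reducedCon {J : Var D → Matrix (Fin 2) (Fin 2) ℝ}
    {J' : Var D →L[ℝ] Matrix (Fin 2) (Fin 2) ℝ} {x : Var D} (hJ : HasFDerivAt J J' x)
    (hx : IsUnit (J x)) (k : ReducedCon D) :
    HasFDerivAt (reducedCon J k) (reducedDeriv (J x) J' k) x := by
  match k with
  | .inl _ => exact (hasFDerivAt_trace_inv hJ hx).sub_const _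
  | .inr (.inl S) => exact (linCon (.inr S)).hasFDerivAt
  | .inr (.inr p) => exact (hasFDerivAt_bits p.1 p.2 x).neg

theorem contDiffAt_reducedCon {J : Var D → Matrix (Fin 2) (Fin 2) ℝ} {x : Var D}
    (hJ : ContDiffAt ℝ ω J x) (hx : IsUnit (J x))
    (k : ReducedCon D) :
    ContDiffAt ℝ ω (reducedCon J k) x := by
  match k with
  | .inl _ => exact (contDiffAt_trace_inv hJ hx).sub contDiffAt_const
  | .inr (.inl S) => exact (linCon (.inr S)).contDiff.contDiffAt
  | .inr (.inr p) =>
    exact (EuclideanSpace.proj (Sum.inl p) : Var D →L[ℝ] ℝ).contDiff.neg.contDiffAt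

variable (T : KLT D)

theorem posDef_fisher_of_isFeasible {y : Var D} (hy : IsFeasible (domain D) (conModel T y) y) :
    (fisher T y).PosDef ∧ (fisher T y)⁻¹.trace ≤ D.ε := by
  have hG := hy.2 (.inl ())
  rw [conModel_self_inl, neg_nonpos] at hG
  have hsymm : (blockMat (aux y) (fisher T y)).IsSymm :=
    hy.1.2.2.fromBlocks Matrix.transpose_one (fisherSurr_self T y ▸ isSymm_fisherSurr T y y)
  have hpsd := (minEig_nonneg_iff_posSemidef hsymm).1 hG
  exact ⟨posDef_of_posSemidef_fromBlocks hpsd,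
    (trace_inv_le_of_posSemidef_fromBlocks hpsd).trans (sub_nonpos.1 (hy.2 (.inr (.inl ()))))⟩

theorem reducedCon_nonpos_of_isFeasible {y : Var D}
    (hy : IsFeasible (domain D) (conModel T y) y)
    (k : ReducedCon D) :
    reducedCon (fisher T) k y ≤ 0 := by
  match k with
  | .inl _ => exact sub_nonpos.2 (posDef_fisher_of_isFeasible T hy).2
  | .inr (.inl S) => exact (linCon_inr_apply S y).trans_le (hy.2 (.inr (.inr S)))
  | .inr (.inr p) => exact neg_nonpos.2 (hy.1.1 p.1 p.2)

/-- `z` with its auxiliary matrix replaced by `M`. -/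
noncomputable def withAux (z : Var D) (M : Matrix (Fin 2) (Fin 2) ℝ) : Var D :=
  WithLp.toLp 2 <| Sum.elim (fun p => bits z p.1 p.2) <|
    Sum.elim (fun _ => uses z) fun q => M q.1 q.2

theorem exists_conModel_neg_of_reducedCon_neg {y z : Var D} (hz : 0 < uses z)
    (hJ : (fisherSurr T y z).PosDef) (hneg : ∀ k, reducedCon (fisherSurr T y) k z < 0) :
    ∃ w ∈ domain D, uses w = uses z ∧ ∀ i, conModel T y i w < 0 := by
  have hgap : 0 < D.ε - (fisherSurr T y z)⁻¹.trace := sub_pos.2 (sub_neg.1 (hneg (.inl ())))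
  let κ : ℝ := (D.ε - (fisherSurr T y z)⁻¹.trace) / 4
  let M := (fisherSurr T y z)⁻¹ + κ • 1
  have hpos : (blockMat M (fisherSurr T y z)).PosDef :=
    posDef_fromBlocks_inv_add_smul hJ (by positivity)
  have hsymm : (blockMat M (fisherSurr T y z)).IsSymm :=
    Matrix.isHermitian_iff_isSymm.1 hpos.isHermitian
  refine ⟨withAux z M, ⟨fun n j => (neg_neg_iff_pos.1 (hneg (.inr (.inr ⟨n, j⟩)))).le, hz, ?_⟩,
    rfl, fun i => ?_⟩
  · exact hsymm.submatrix (Sum.inl : Fin 2 → Fin 2 ⊕ Fin 2)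
  match i with
  | .inl _ => exact neg_neg_iff_pos.2 ((minEig_pos_iff_posDef hsymm).2 hpos)
  | .inr (.inl _) =>
    change M.trace - D.ε < 0
    rw [Matrix.trace_add, Matrix.trace_smul, Matrix.trace_one, Fintype.card_fin, smul_eq_mul]
    simp only [κ]
    push_cast
    linarith
  | .inr (.inr S) => exact (linCon_inr_apply S z).symm.trans_lt (hneg (.inr (.inl S)))

theorem exists_reducedDeriv_neg {y : Var D} (hJ : (fisher T y).PosDef) :
    ∃ d, ∀ k, reducedDeriv (fisher T y) (fisherDeriv T y) k d < 0 := by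
  let w : (n : D.Ω) → D.Idx n → ℝ := fun n j =>
    yfun T n j (bits y n j) / ySlope T n j (bits y n j)
  obtain ⟨t, ht⟩ : ∃ t : ℝ, ∀ S : {S : Finset D.Ω // S.Nonempty},
      ∑ n ∈ S.1, ∑ j, w n j < t * capacity D S.1 :=
    (eventually_all.2 fun S => (tendsto_id.atTop_mul_const
      (capacity_pos S.2)).eventually_gt_atTop _).exists
  let d : Var D := WithLp.toLp 2 <| Sum.elim (fun p => w p.1 p.2) <|
    Sum.elim (fun _ => t) fun _ => 0
  refine ⟨d, fun k => ?_⟩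
  match k with
  | .inl _ =>
    have hd : fisherDeriv T y d = fisher T y := by
      rw [fisherDeriv_apply, fisher_eq_info]
      congr! 3 with n j
      exact mul_div_cancel₀ _ (ySlope_pos T n j _).ne'
    have htrace : 0 < (fisher T y)⁻¹.trace := hJ.inv.trace_pos
    have hinv := Matrix.nonsing_inv_mul _ ((Matrix.isUnit_iff_isUnit_det _).1 hJ.isUnit)
    simpa [reducedDeriv, hd, hinv] using htrace
  | .inr (.inl S) => exact (linCon_inr_apply S d).trans_lt (sub_neg.2 (ht S))
  | .inr (.inr p) =>
    exact neg_neg_iff_pos.2 (div_pos (yfun_pos T p.1 p.2 _) (ySlope_pos T p.1 p.2 _))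

theorem eventually_reducedCon_fisherSurr_neg {y d : Var D} (hJ : (fisher T y).PosDef)
    (hcon : ∀ k, reducedCon (fisher T) k y ≤ 0)
    (hd : ∀ k, reducedCon (fisher T) k y + reducedDeriv (fisher T y) (fisherDeriv T y) k d < 0) :
    ∀ᶠ s : ℝ in 𝓝[>] 0, ∀ k, reducedCon (fisherSurr T y) k (y + s • d) < 0 := by
  refine eventually_all.2 fun k => ?_
  have hval := reducedCon_congr (fisherSurr_self T y) k
  have hderiv := hasFDerivAt_reducedCon (hasFDerivAt_fisherSurr T y y)
    (by rw [fisherSurr_self]; exact hJ.isUnit) k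
  rw [fisherSurr_self] at hderiv
  exact eventually_neg_of_hasFDerivAt hderiv (hval.trans_le (hcon k))
    ((congrArg (· + _) hval).trans_lt (hd k))

theorem usesCLM_nonneg_of_isCritical {y : Var D} (hy : 0 < uses y) (hJ : (fisher T y).PosDef)
    (hcon : ∀ k, reducedCon (fisher T) k y ≤ 0)
    (hcrit : IsCritical (domain D) usesCLM (conModel T) y) {d : Var D}
    (hd : ∀ k, reducedCon (fisher T) k y + reducedDeriv (fisher T y) (fisherDeriv T y) k d < 0) :
    0 ≤ usesCLM d := by
  by_contra! hd₀
  have hcurve : Tendsto (fun s : ℝ => y + s • d) (𝓝[>] 0) (𝓝 y) := by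
    have : Continuous fun s : ℝ => y + s • d := by fun_prop
    simpa using (this.tendsto 0).mono_left nhdsWithin_le_nhds
  have hpos : ∀ᶠ s : ℝ in 𝓝[>] 0, (fisherSurr T y (y + s • d)).PosDef := by
    have hlim := ((continuous_minEig.tendsto _).comp
      (hasFDerivAt_fisherSurr T y y).continuousAt.tendsto).comp hcurve
    have hy₀ : 0 < minEig (fisherSurr T y y) := by
      rwa [minEig_pos_iff_posDef (isSymm_fisherSurr T y y), fisherSurr_self]
    filter_upwards [hlim.eventually_const_lt hy₀] with s hs
    exact (minEig_pos_iff_posDef (isSymm_fisherSurr T y _)).1 hs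
  have huses : ∀ᶠ s : ℝ in 𝓝[>] 0, 0 < uses (y + s • d) :=
    ((usesCLM.continuous.tendsto y).comp hcurve).eventually_const_lt hy
  obtain ⟨s, hs₁, hs₂, hs₃, hs⟩ := ((eventually_reducedCon_fisherSurr_neg T hJ hcon hd).and
    (hpos.and (huses.and eventually_mem_nhdsWithin))).exists
  obtain ⟨w, hw, hwu, hwneg⟩ := exists_conModel_neg_of_reducedCon_neg T hs₃ hs₂ hs₁
  have hlt : usesCLM w < usesCLM y := by
    rw [show usesCLM w = usesCLM (y + s • d) from hwu, map_add, map_smul]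
    exact add_lt_of_neg_right _ (mul_neg_of_pos_of_neg hs hd₀)
  obtain ⟨i, hi⟩ := hcrit w hw hlt
  exact (hwneg i).not_ge hi

theorem volume_usesCLM_image_critical_eq_zero : MeasureTheory.volume (usesCLM ''
    {y : Var D | IsFeasible (domain D) (conModel T y) y ∧
      IsCritical (domain D) usesCLM (conModel T) y}) = 0 := by
  refine volume_image_kkt_eq_zero (g := reducedCon (fisher T))
    (fun y _ => usesCLM.contDiff.contDiffAt) (fun y hy => contDiffAt_reducedCon
      (contDiff_fisher T).contDiffAt (posDef_fisher_of_isFeasible T hy.1).1.isUnit)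
    fun y ⟨hfeas, hcrit⟩ => ?_
  have hJ := (posDef_fisher_of_isFeasible T hfeas).1
  have hcon := reducedCon_nonpos_of_isFeasible T hfeas
  obtain ⟨d, hd⟩ := exists_reducedDeriv_neg T hJ
  obtain ⟨lam, hlam, hcs, hsum⟩ := exists_kkt_multipliers hcon
    (fun d hd => usesCLM_nonneg_of_isCritical T hfeas.1.2.1 hJ hcon hcrit hd)
    ⟨d, fun k => add_neg_of_nonpos_of_neg (hcon k) (hd k)⟩
  refine ⟨lam, hlam, hcs, ContinuousLinearMap.ext fun d => ?_⟩
  simpa [(hasFDerivAt_reducedCon (hasFDerivAt_fisher T y) hJ.isUnit _).fderiv] using hsum d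

end Reduced

/-! ### Stationarity of critical points -/

section Stationarity

variable {ι : Type*} {D : Scenario ι} (T : KLT D)

open InnerProductSpace in
theorem exists_subgradient_of_isCritical {y : Var D}
    (hfeas : IsFeasible (domain D) (conModel T y) y)
    (hcrit : IsCritical (domain D) usesCLM (conModel T) y)
    (hslater : ∃ z ∈ domain D, ∀ i, conModel T y i z < 0) :
    ∃ (lam : Con D → ℝ) (ξ : Var D), (∀ i, 0 ≤ lam i) ∧ (∀ i, lam i * conModel T y i y = 0) ∧
      (∀ z, conModel T y (.inl ()) y + ⟪ξ, z - y⟫_ℝ ≤ conModel T y (.inl ()) z) ∧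
      -((toDual ℝ (Var D)).symm usesCLM + (lam (.inl ()) • ξ +
        ∑ k, lam (.inr k) • (toDual ℝ (Var D)).symm (linCon k))) ∈ normalCone (domain D) y := by
  obtain ⟨z₀, hz₀, hneg⟩ := hslater
  obtain ⟨lam, hlam, hcs, hle⟩ := exists_lagrange_multipliers
    ((usesCLM.toLinearMap.convexOn convex_domain).sub (concaveOn_const (usesCLM y) convex_domain))
    (fun i => (convexOn_conModel T y i).subset (Set.subset_univ _) convex_domain)
    (fun z hz hlt => hcrit z hz (sub_neg.1 hlt)) hz₀ hneg hfeas.1 (sub_self _) hfeas.2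
  have hinr : ∀ k, lam (.inr k) * (linCon k y - linBound D k) = 0 := fun k => by
    rw [← con_linear_inr T]
    exact hcs (.inr k)
  have hnonneg : ∀ z ∈ domain D, 0 ≤ usesCLM z - usesCLM y + (lam (.inl ()) *
      conModel T y (.inl ()) z + ∑ k, lam (.inr k) * (linCon k z - linBound D k)) :=
    fun z hz => by
      simp only [← con_linear_inr T]
      have := hle z hz
      rwa [Fintype.sum_sum_type, Fintype.sum_unique] at this
  have hcont := (continuous_conModel T (.inl ())).comp (Continuous.prodMk_right y)
  obtain ⟨ξ, hξ, hcone⟩ := exists_subgradient_of_lagrangian_nonneg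
    (convexOn_conModel T y (.inl ())) hcont convex_domain hfeas.1 (hlam (.inl ()))
    (hcs (.inl ())) hinr hnonneg
  exact ⟨lam, ξ, hlam, hcs, hξ, hcone⟩

theorem exists_mem_subdiff_con_inr (F : CapacityForm)
    (k : Unit ⊕ {S : Finset D.Ω // S.Nonempty}) {y : Var D} (hy : 0 < uses y) {l : ℝ}
    (hl : l * conModel T y (.inr k) y = 0) :
    ∃ ξ ∈ subdiff (con T F (.inr k)) y, (conScale F (.inr k) y * l) • ξ =
      l • (InnerProductSpace.toDual ℝ (Var D)).symm (linCon k) := by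
  obtain ⟨s', hs⟩ : ∃ s' : Var D →L[ℝ] ℝ, HasFDerivAt (conScale (D := D) F (.inr k)) s' y := by
    match F, k with
    | .ratio, .inr S => exact ⟨usesCLM, usesCLM.hasFDerivAt⟩
    | .ratio, .inl _ | .linear, .inl _ | .linear, .inr _ => exact ⟨0, hasFDerivAt_const 1 y⟩
  have hg : HasFDerivAt (con T .linear (.inr k)) (linCon k) y :=
    ((linCon k).hasFDerivAt.sub_const (linBound D k)).congr_of_eventuallyEq
      (.of_forall (con_linear_inr T k))
  refine exists_mem_subdiff_of_mul_eventuallyEq hg hs (conScale_pos F _ hy).ne' ?_ hl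
  filter_upwards [usesCLM.continuous.continuousAt.eventually (lt_mem_nhds hy)] with z hz
  exact conScale_mul_con T F (.inr k) hz

theorem mem_subdiff_con_inl (F : CapacityForm) {y ξ : Var D}
    (hξ : ∀ z, conModel T y (.inl ()) y + ⟪ξ, z - y⟫_ℝ ≤ conModel T y (.inl ()) z) :
    ξ ∈ subdiff (con T F (.inl ())) y := by
  obtain ⟨C, -, hC⟩ := exists_abs_conModel_sub_le T
  refine mem_subdiff_of_sq_minorant (C := C) (conModel_self_inl T y).symm (fun z => ?_) hξ
  have := (abs_le.1 (hC y z (.inl ()))).1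
  change _ ≤ -minEig (blockMat (aux z) (fisher T z))
  rw [conModel_self_inl] at this
  linarith

theorem isKKT_of_isCritical (F : CapacityForm) {y : Var D}
    (hfeas : IsFeasible (domain D) (conModel T y) y)
    (hcrit : IsCritical (domain D) usesCLM (conModel T) y)
    (hslater : ∃ z ∈ domain D, ∀ i, conModel T y i z < 0) :
    IsKKT (domain D) uses (con T F) y := by
  have hy : 0 < uses y := hfeas.1.2.1
  obtain ⟨lam, ξ, hlam, hcs, hξ, hcone⟩ :=
    exists_subgradient_of_isCritical T hfeas hcrit hslater
  choose ζ hζ hζeq using fun k => exists_mem_subdiff_con_inr T F k hy (hcs (.inr k))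
  refine ⟨⟨hfeas.1, fun i => ?_⟩, fun i => conScale F i y * lam i,
    (InnerProductSpace.toDual ℝ (Var D)).symm usesCLM, Sum.elim (fun _ => ξ) ζ, _,
    fun i => mul_nonneg (conScale_pos F i hy).le (hlam i), fun i => ?_,
    mem_subdiff_of_hasFDerivAt ?_, ?_, hcone, ?_⟩
  · exact nonpos_of_mul_nonpos_right (conScale_mul_con T F i hy ▸ hfeas.2 i) (conScale_pos F i hy)
  · rw [mul_right_comm, conScale_mul_con T F i hy, mul_comm, hcs]
  · refine (usesCLM (D := D)).hasFDerivAt.congr_fderiv (ContinuousLinearMap.ext fun w => ?_)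
    rw [innerSL_apply_apply, InnerProductSpace.toDual_symm_apply]
  · rintro (_ | k)
    exacts [mem_subdiff_con_inl T F hξ, hζ k]
  · simp only [Fintype.sum_sum_type (α₁ := Unit) (α₂ := Unit ⊕ _), Fintype.sum_unique,
      Sum.elim_inl, Sum.elim_inr, hζeq]
    rw [show conScale F (.inl ()) y = 1 from by cases F <;> rfl, one_mul]
    exact add_neg_cancel _

end Stationarity

/-! ### The iterates -/

section Iterates

variable {ι : Type*} {D : Scenario ι} {T : KLT D} {F : CapacityForm} {μ : ℝ}

theorem Slater.exists_conModel_neg {x : ℕ → Var D} {φ : ℕ → ℕ} (hslater : Slater T F μ x φ)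
    (hμ : 0 ≤ μ) {y : Var D} (hlim : Tendsto (fun k => x (φ k)) atTop (𝓝 y)) :
    ∃ z ∈ domain D, ∀ i, conModel T y i z < 0 := by
  obtain ⟨flim, hconv, z, hz, hneg⟩ := hslater
  have hzd := intrinsicInterior_subset hz
  refine ⟨z, hzd, fun i => ?_⟩
  have hmodel := ((continuous_conModel T i).tendsto (y, z)).comp
    (hlim.prodMk_nhds tendsto_const_nhds)
  refine (le_of_tendsto_of_tendsto' hmodel ((hconv i z hzd).const_mul (conScale F i z))
    fun k => ?_).trans_lt (mul_neg_of_pos_of_neg (conScale_pos F i hzd.2.1) (hneg i))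
  rw [conScale_mul_conSurr T F μ _ i hzd.2.1]
  have := (conScale_pos F i hzd.2.1).le
  exact le_add_of_nonneg_right (by positivity)

theorem IsMCSCA.isTrustRegionDescent {β : ℕ → ℝ} {x : ℕ → Var D} (hx : IsMCSCA T F μ β x)
    (hμ : 0 ≤ μ) : IsTrustRegionDescent (domain D) usesCLM (conModel T) (fun t => |β t|) x where
  mem
    | 0 => hx.1.1
    | t + 1 => (hx.2 t).1.1.1
  norm_sub_le t := abs_norm (x (t + 1) - x t) ▸ sq_le_sq.1 (hx.2 t).1.1.2
  exists_model_le := by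
    obtain ⟨C, hC, hle⟩ := exists_abs_conModel_sub_le T
    refine ⟨C, hC, fun t i => ?_⟩
    obtain ⟨⟨hmem, htrust⟩, hcon⟩ := (hx.2 t).1
    have hpos := conScale_pos F i hmem.2.1
    have hscaled := mul_nonpos_of_nonneg_of_nonpos hpos.le (hcon i)
    rw [conScale_mul_conSurr T F μ _ i hmem.2.1] at hscaled
    have hprox : 0 ≤ conScale F i (x (t + 1)) * (μ * ‖x (t + 1) - x t‖ ^ 2) := by positivity
    have herr := (le_abs_self _).trans (hle (x t) (x (t + 1)) i)
    have := mul_le_mul_of_nonneg_left htrust hC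
    rw [sq_abs]
    linarith
  exists_objective_le B := by
    refine ⟨μ * (1 + |B|), fun t z hz hzt huses hcon => ?_⟩
    have htrust : ‖z - x t‖ ^ 2 ≤ β t ^ 2 := sq_le_sq.2 (by rwa [abs_norm])
    have hprox : μ * ‖z - x t‖ ^ 2 ≤ μ * β t ^ 2 := mul_le_mul_of_nonneg_left htrust hμ
    have hfeas : ∀ i, conSurr T F μ (x t) i z ≤ 0 := fun i => by
      have hpos := conScale_pos F i hz.2.1
      have hscale : conScale F i z ≤ 1 + |B| :=
        (conScale_le F i hz.2.1).trans (by gcongr; exact huses.trans (le_abs_self B))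
      refine nonpos_of_mul_nonpos_right ?_ hpos
      rw [conScale_mul_conSurr T F μ _ i hz.2.1]
      calc _ ≤ conModel T (x t) i z + (1 + |B|) * (μ * β t ^ 2) := by gcongr
        _ ≤ 0 := by rw [← sq_abs (β t)]; linarith [hcon i]
    have hmin : uses (x (t + 1)) + μ * ‖x (t + 1) - x t‖ ^ 2 ≤ uses z + μ * ‖z - x t‖ ^ 2 :=
      (hx.2 t).2 z ⟨⟨hz, htrust⟩, hfeas⟩
    change uses (x (t + 1)) ≤ uses z + _
    have := mul_nonneg (mul_nonneg hμ (abs_nonneg B)) (sq_nonneg (β t))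
    have := mul_nonneg hμ (sq_nonneg ‖x (t + 1) - x t‖)
    rw [sq_abs]
    linarith

end Iterates

end MCSCA

theorem theorem1_general {ι : Type*} {D : MCSCA.Scenario ι} {T : MCSCA.KLT D}
    {F : MCSCA.CapacityForm} {μ : ℝ} (hμ : 0 ≤ μ) {β : ℕ → ℝ} (hβ_lim : Tendsto β atTop (𝓝 0))
    (hβ_sum : Tendsto (fun m => ∑ t ∈ Finset.range m, β t) atTop atTop)
    {x : ℕ → MCSCA.Var D} (hx : MCSCA.IsMCSCA T F μ β x) {xstar : MCSCA.Var D}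
    (hpos : 0 < MCSCA.uses xstar) {φ : ℕ → ℕ} (hφ : Tendsto φ atTop atTop)
    (hlim : Tendsto (fun k => x (φ k)) atTop (𝓝 xstar)) (hslater : MCSCA.Slater T F μ x φ) :
    MCSCA.IsKKT (MCSCA.domain D) MCSCA.uses (MCSCA.con T F) xstar := by
  have hdescent := hx.isTrustRegionDescent hμ
  have hmodel := MCSCA.isConvexModel_conModel T
  have habs_lim : Tendsto (fun t => |β t|) atTop (𝓝 0) := by simpa using hβ_lim.abs
  have habs_sum : Tendsto (fun m => ∑ t ∈ Finset.range m, |β t|) atTop atTop :=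
    tendsto_atTop_mono (fun m => Finset.sum_le_sum fun t _ => le_abs_self (β t)) hβ_sum
  have hfeas := hdescent.isFeasible_of_tendsto hmodel habs_lim hφ hlim hpos
  have hcrit := hdescent.isCritical_of_tendsto hmodel habs_lim habs_sum
    (MCSCA.volume_usesCLM_image_critical_eq_zero T) hφ hlim hpos
  exact MCSCA.isKKT_of_isCritical T F hfeas hcrit (hslater.exists_conModel_neg hμ hlim)

theorem theorem1 {ι : Type*} (D : MCSCA.Scenario ι) (T : MCSCA.KLT D) (F : MCSCA.CapacityForm)
    (μ : ℝ) (hμ : 0 < μ)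
    (β : ℕ → ℝ) (hβ_anti : Antitone β) (hβ_lim : Tendsto β atTop (𝓝 0))
    (hβ_sum : Tendsto (fun m => ∑ t ∈ Finset.range m, β t) atTop atTop)
    (x : ℕ → MCSCA.Var D) (hx : MCSCA.IsMCSCA T F μ β x)
    (xstar : MCSCA.Var D) (hdom : xstar ∈ MCSCA.domain D)
    (φ : ℕ → ℕ) (hφ : StrictMono φ) (hlim : Tendsto (fun k => x (φ k)) atTop (𝓝 xstar))
    (hslater : MCSCA.Slater T F μ x φ) :
    MCSCA.IsKKT (MCSCA.domain D) MCSCA.uses (MCSCA.con T F) xstar :=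
  theorem1_general hμ.le hβ_lim hβ_sum hx hdom.2.1 hφ.tendsto_atTop hlim hslater
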